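/- Logarithms are to base $2$, $[M]=\{1,\dots,M\}$, and $[a:b]$ is the set of integers between $a$ and $b$. Locations in strings are numbered from $1$, and $y_{[a:b]}=(y_a,\dots,y_b)$. The edit distance is $d_{\mathrm{edit}}(u,v)=|u|+|v|-2\,|\mathrm{LCS}(u,v)|$, where $\mathrm{LCS}$ is a longest common subsequence. **Model.** Let $x\in\{0,1\}^n$ be uniform. A trace of $x$ is obtained by deleting each bit independently with probability $\delta$ and concatenating the surviving bits. Given $x$, let $y^*,y^{(1)},\dots,y^{(M)}$ be independent traces. Write $\mathrm{source}^*(q)$ (resp. $\mathrm{source}^{(m)}(q)$) for the location in $x$ of the bit that became the $q$-th bit of $y^*$ (resp. $y^{(m)}$). **Parameters.** $\gamma=0.01$, $\tau=5/\gamma=500$, and for $K>0$ $$H=\frac MK\log\frac1{\delta M},\qquad t_1=2\lceil H\rceil+1,\qquad t_{s+1}=3t_s,$$ and $S\ge 1$ is the least integer with $t_S\ge\tau\log n$. **Algorithm Align.** The input is $y^*,y^{(1)},\dots,y^{(M)}$ and an integer $\ell^*\in[5\tau\log n:|y^*|-5\tau\log n]$. Let $w_s^*=y^*_{[\ell^*-(t_s-1)/2\,:\,\ell^*+(t_s-1)/2]}$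 for $s=1,\dots,S$. *First stage.* For each $m\in[M]$ put $Q^m_{S+1}=[1:|y^{(m)}|]$, and for $s=S,\dots,1$ choose any non-empty interval $Q_s^m\subseteq Q_{s+1}^m$ with $d_{\mathrm{edit}}(w_s^*,y^{(m)}_{Q^m_s})\le 2\gamma t_s$. If no such interval exists, return $\ell^{(1)}=\dots=\ell^{(M)}=1$. *Second stage.* Choose any string $w$ of length at least $0.9\,t_1$ that occurs as a subword (contiguous) in at least $95\%$ of the strings $y^{(m)}_{Q_1^m}$, $m\in[M]$. If there is none, return $\ell^{(1)}=\dots=\ell^{(M)}=1$. Otherwise, for each $m$, let $\ell^{(m)}$ be the location in $y^{(m)}$ of the start of any occurrence of $w$ inside $y^{(m)}_{Q_1^m}$, or $\ell^{(m)}=1$ if there is no occurrence. Return $\ell^{(1)},\dots,\ell^{(M)}$. All choices are arbitrary; any fixed rule for making them turns Align into a deterministic algorithm. **Theorem.** There is an absolute constant $K_0>0$ such that the following holds for every real $K\ge K_0$, all positive integers $n$ and $M$, and every real $\delta$ with $$\frac1{n^2}\le\delta<\frac1{KM}<\frac1K,\qquad K^2\le M\le\frac1{K\delta},\qquad H\le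 2\log n .$$ With probability at least $1-1/n^2$ over $x,y^*,y^{(1)},\dots,y^{(M)}$, for all but at most $2^{-0.1H}n$ of the integers $\ell^*\in[5\tau\log n:|y^*|-5\tau\log n]$, every tuple $(\ell^{(1)},\dots,\ell^{(M)})$ that Align can return on input $\ell^*,y^*,y^{(1)},\dots,y^{(M)}$ (however the choices are made) satisfies: there is a location $i\in\{1,\dots,n\}$ such that 1. $\mathrm{source}^{(m)}(\ell^{(m)})=i$ for at least $90\%$ of the $m\in[M]$, and 2. $\mathrm{source}^*(\ell^*)-2H\le i\le\mathrm{source}^*(\ell^*)$. -/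

import Mathlib

open MeasureTheory ProbabilityTheory

namespace TraceAlign

/-! ### Deletion channel -/

/-- A pattern of deletions of an `n`-bit string: `D i = true` means that bit `i` is deleted.
Locations of the source string are elements of `Fin n`; only order and differences of
source locations are ever used. -/
abbrev Deletions (n : ℕ) : Type := Fin n → Bool

/-- The locations that survive, in increasing order. -/
def kept {n : ℕ} (D : Deletions n) : List (Fin n) :=
  (List.finRange n).filter fun i => !(D i)

/-- The trace of `x` under the deletion pattern `D`: the surviving bits, concatenated. -/
def trace {n : ℕ} (x : Fin n → Bool) (D : Deletions n) : List Bool :=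
  (kept D).map x

/-- `source(q) = i`: bit `i` of the source string gave rise to the `q`-th bit of the trace.
Locations in traces are numbered from `1`. -/
def IsSource {n : ℕ} (D : Deletions n) (q : ℕ) (i : Fin n) : Prop :=
  1 ≤ q ∧ (kept D)[q - 1]? = some i

/-- Law of one deletion flag: `true` with probability `δ`, `false` with probability `1 - δ`. -/
noncomputable def flagLaw (δ : ℝ) : Measure Bool :=
  ENNReal.ofReal δ • Measure.dirac true + ENNReal.ofReal (1 - δ) • Measure.dirac false

/-- Every location is deleted independently with probability `δ`. -/
noncomputable def deletionLaw (n : ℕ) (δ : ℝ) : Measure (Deletions n) :=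
  Measure.pi fun _ => flagLaw δ

/-- A source string, the deletion pattern of the reference trace and the deletion patterns of
the `M` other traces. -/
abbrev Outcome (n M : ℕ) : Type :=
  (Fin n → Bool) × Deletions n × (Fin M → Deletions n)

/-- The source string is uniform, and the `M + 1` deletion patterns are drawn independently of
each other and of the source string. -/
noncomputable def outcomeLaw (n M : ℕ) (δ : ℝ) : Measure (Outcome n M) :=
  (uniformOn (Set.univ : Set (Fin n → Bool))).prod
    ((deletionLaw n δ).prod (Measure.pi fun _ : Fin M => deletionLaw n δ))

/-! ### Strings -/

/-- The subword `y_{[a:b]}` (locations numbered from `1`), for `Q = (a, b)`. -/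
def subword (y : List Bool) (Q : ℕ × ℕ) : List Bool :=
  (y.drop (Q.1 - 1)).take (Q.2 + 1 - Q.1)

/-- Length of a longest common subsequence. -/
noncomputable def lcsLength (x y : List Bool) : ℕ :=
  sSup {k | ∃ z : List Bool, z.Sublist x ∧ z.Sublist y ∧ z.length = k}

/-- Edit distance with insertions and deletions. The subtraction does not truncate, because
a common subsequence is no longer than `x` and no longer than `y`. -/
noncomputable def editDist (x y : List Bool) : ℕ :=
  x.length + y.length - 2 * lcsLength x y

/-- `w` occurs in `y_{[Q.1:Q.2]}` as the subword that starts at location `p` of `y`. -/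
def OccursAt (w y : List Bool) (Q : ℕ × ℕ) (p : ℕ) : Prop :=
  Q.1 ≤ p ∧ p + w.length ≤ Q.2 + 1 ∧ (y.drop (p - 1)).take w.length = w

/-! ### Parameters -/

noncomputable def gammaC : ℝ := 0.01

noncomputable def tauC : ℝ := 5 / gammaC

/-- `H = (M / K) log₂ (1 / (δ M))`. -/
noncomputable def scaleH (K δ : ℝ) (M : ℕ) : ℝ :=
  M / K * Real.logb 2 (1 / (δ * M))

/-- `t_s` for `s ≥ 1`, where `t_1 = 2 h + 1` and `t_{s+1} = 3 t_s`. The algorithm is run with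
the integer `h = ⌈H⌉`, so that `t_1` is an odd integer. -/
def windowLen (h s : ℕ) : ℕ := 3 ^ (s - 1) * (2 * h + 1)

/-- `S`, the least `s ≥ 1` with `t_s ≥ τ log₂ n`. -/
noncomputable def numLevels (n h : ℕ) : ℕ :=
  sInf {s | 1 ≤ s ∧ tauC * Real.logb 2 n ≤ windowLen h s}

/-- `Q*_s`, the interval of length `t_s` centred at `ℓ*`. -/
def refWindow (h ℓstar s : ℕ) : ℕ × ℕ :=
  (ℓstar - (windowLen h s - 1) / 2, ℓstar + (windowLen h s - 1) / 2)

/-! ### The algorithm Align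

Align breaks ties arbitrarily. It is therefore given by the relation `IsAlignOutput` between an
input and the tuples of pointers that it can return on this input, over all ways of
breaking ties. -/

/-- `Q'` is an interval inside `Q`, and `y_{Q'}` has edit distance at most `2 γ t_s` from
`w*_s = y*_{Q*_s}`. -/
def IsMatch (h ℓstar : ℕ) (ystar y : List Bool) (s : ℕ) (Q Q' : ℕ × ℕ) : Prop :=
  Q.1 ≤ Q'.1 ∧ Q'.1 ≤ Q'.2 ∧ Q'.2 ≤ Q.2 ∧
    (editDist (subword ystar (refWindow h ℓstar s)) (subword y Q') : ℝ) ≤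
      2 * gammaC * windowLen h s

/-- First stage for one trace `y`. `Narrows h ℓ* y* y s Q r` says that the loop over the levels
`s, s - 1, …, 1`, started with the interval `Q = Q_{s+1}`, can end with `r`: the interval `Q_1`
found at level `1`, or `none` if at some level there is no suitable subword. -/
inductive Narrows (h ℓstar : ℕ) (ystar y : List Bool) :
    ℕ → ℕ × ℕ → Option (ℕ × ℕ) → Prop
  | done (Q : ℕ × ℕ) : Narrows h ℓstar ystar y 0 Q (some Q)
  | step (s : ℕ) (Q Q' : ℕ × ℕ) (r : Option (ℕ × ℕ)) :
      IsMatch h ℓstar ystar y (s + 1) Q Q' → Narrows h ℓstar ystar y s Q' r →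
        Narrows h ℓstar ystar y (s + 1) Q r
  | stuck (s : ℕ) (Q : ℕ × ℕ) :
      (∀ Q', ¬ IsMatch h ℓstar ystar y (s + 1) Q Q') →
        Narrows h ℓstar ystar y (s + 1) Q none

/-- `w` has length at least `0.9 t_1` and is a subword of at least 95% of the
`y^{(m)}_{Q^m}`. -/
def IsCommonWord {M : ℕ} (h : ℕ) (y : Fin M → List Bool) (Q : Fin M → ℕ × ℕ)
    (w : List Bool) : Prop :=
  (0.9 : ℝ) * windowLen h 1 ≤ w.length ∧
    (0.95 : ℝ) * M ≤ ({m | ∃ p, OccursAt w (y m) (Q m) p} : Set (Fin M)).ncard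

/-- Second stage: `ℓ` can be returned when the first stage has found the intervals
`Q^m = Q^m_1`. -/
def SecondStage {M : ℕ} (h : ℕ) (y : Fin M → List Bool) (Q : Fin M → ℕ × ℕ)
    (ℓ : Fin M → ℕ) : Prop :=
  ((¬ ∃ w, IsCommonWord h y Q w) ∧ ℓ = fun _ => 1) ∨
    ∃ w, IsCommonWord h y Q w ∧
      ∀ m, OccursAt w (y m) (Q m) (ℓ m) ∨
        ((¬ ∃ p, OccursAt w (y m) (Q m) p) ∧ ℓ m = 1)

/-- Align can return `ℓ` on input `ℓ*, y*, y^{(1)}, …, y^{(M)}` (with parameters `n` and `h`).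
All pointers are `1` if the first stage fails for some trace. -/
def IsAlignOutput {M : ℕ} (n h ℓstar : ℕ) (ystar : List Bool) (y : Fin M → List Bool)
    (ℓ : Fin M → ℕ) : Prop :=
  ∃ r : Fin M → Option (ℕ × ℕ),
    (∀ m, Narrows h ℓstar ystar (y m) (numLevels n h) (1, (y m).length) (r m)) ∧
    (((∃ m, r m = none) ∧ ℓ = fun _ => 1) ∨
      ∃ Q : Fin M → ℕ × ℕ, (∀ m, r m = some (Q m)) ∧ SecondStage h y Q ℓ)

theorem exists_narrows (h ℓstar : ℕ) (ystar y : List Bool) (s : ℕ) (Q : ℕ × ℕ) :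
    ∃ r, Narrows h ℓstar ystar y s Q r := by
  induction s generalizing Q with
  | zero => exact ⟨_, .done Q⟩
  | succ s ih =>
    by_cases hQ : ∃ Q', IsMatch h ℓstar ystar y (s + 1) Q Q'
    · obtain ⟨Q', hQ'⟩ := hQ
      obtain ⟨r, hr⟩ := ih Q'
      exact ⟨r, .step s Q Q' r hQ' hr⟩
    · exact ⟨none, .stuck s Q fun Q' h' => hQ ⟨Q', h'⟩⟩

/-- Align returns an output on every input. -/
theorem exists_isAlignOutput {M : ℕ} (n h ℓstar : ℕ) (ystar : List Bool)
    (y : Fin M → List Bool) : ∃ ℓ : Fin M → ℕ, IsAlignOutput n h ℓstar ystar y ℓ := by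
  choose r hr using fun m =>
    exists_narrows h ℓstar ystar (y m) (numLevels n h) (1, (y m).length)
  by_cases hf : ∃ m, r m = none
  · exact ⟨_, r, hr, Or.inl ⟨hf, rfl⟩⟩
  · have hs : ∀ m, ∃ Q, r m = some Q := fun m =>
      Option.ne_none_iff_exists'.1 fun h0 => hf ⟨m, h0⟩
    choose Q hQ using hs
    by_cases hw : ∃ w, IsCommonWord h y Q w
    · obtain ⟨w, hw⟩ := hw
      have hℓ : ∀ m, ∃ p, OccursAt w (y m) (Q m) p ∨
          ((¬ ∃ p, OccursAt w (y m) (Q m) p) ∧ p = 1) := fun m => by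
        by_cases hp : ∃ p, OccursAt w (y m) (Q m) p
        · exact ⟨hp.choose, Or.inl hp.choose_spec⟩
        · exact ⟨1, Or.inr ⟨hp, rfl⟩⟩
      choose ℓ hℓ using hℓ
      exact ⟨ℓ, r, hr, Or.inr ⟨Q, hQ, Or.inr ⟨w, hw, hℓ⟩⟩⟩
    · exact ⟨_, r, hr, Or.inr ⟨Q, hQ, Or.inl ⟨hw, rfl⟩⟩⟩

/-! ### Success -/

/-- Success at `ℓ*`: whichever way ties are broken, at least 90% of the returned pointers come
from one source location `i`, and `source*(ℓ*) - 2H ≤ i ≤ source*(ℓ*)`. -/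
def SucceedsAt {n M : ℕ} (K δ : ℝ) (x : Fin n → Bool) (Dstar : Deletions n)
    (D : Fin M → Deletions n) (ℓstar : ℕ) : Prop :=
  ∀ ℓ : Fin M → ℕ,
    IsAlignOutput n ⌈scaleH K δ M⌉₊ ℓstar (trace x Dstar) (fun m => trace x (D m)) ℓ →
      ∃ i j : Fin n, IsSource Dstar ℓstar j ∧
        (0.9 : ℝ) * M ≤ ({m | IsSource (D m) (ℓ m) i} : Set (Fin M)).ncard ∧
        ((j : ℕ) : ℝ) - 2 * scaleH K δ M ≤ ((i : ℕ) : ℝ) ∧ i ≤ j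

/-- Align succeeds on `x` with respect to the traces given by `D*, D^{(1)}, …, D^{(M)}`: it
succeeds at all but at most `2^{-0.1 H} n` of the integers
`ℓ* ∈ [5 τ log₂ n : |y*| - 5 τ log₂ n]`. -/
def AlignSucceeds {n M : ℕ} (K δ : ℝ) (x : Fin n → Bool) (Dstar : Deletions n)
    (D : Fin M → Deletions n) : Prop :=
  (({ℓstar : ℕ | 5 * tauC * Real.logb 2 n ≤ ℓstar ∧
      (ℓstar : ℝ) ≤ (trace x Dstar).length - 5 * tauC * Real.logb 2 n ∧
      ¬ SucceedsAt K δ x Dstar D ℓstar} : Set ℕ).ncard : ℝ) ≤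
    (2 : ℝ) ^ (-0.1 * scaleH K δ M) * n

end TraceAlign

/-!
A random string hardly resembles a shifted copy of itself, and this is all that Align needs.

Suppose that two subwords of traces, of length about `t`, have edit distance at most `0.02 t`. A
longest common subsequence pairs off at least `0.98 t` locations of `x`, increasing in both
components (`exists_alignment`). Either some location is paired with itself, and this forces
the two source windows to agree up to about `0.025 t` at both ends, or all pairs consist of distinct
locations. The pairs of the second kind form a forest, so for fixed pairs the bits agree with
probability `2 ^ (-0.98 t)` (`uniformOn_coincidences`). There are only about `2 ^ (0.58 t)` ways to
choose the pairs once the two windows are fixed, so this (`Repeats`) is exponentially unlikely.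

Hence, if `x` does not nearly repeat itself at scale `t` and all traces have few deletions in
windows of length `4 t`, then a suitable match of the reference window exists and every match shows
almost the same source window (`exists_match`, `locates_of_match`). At the top scale this is needed
for matches anywhere in the traces, at a lower scale only for matches inside the window
found before; so the union bound runs over `n ^ 2` cases where `t ≥ 500 log n`, and over
`O(t)` cases at the lower scales. After the first stage all traces show almost the same window of
length about `t₁`. Since `δ M` is small, 95% of the traces have no deletion there, except with
probability `2 ^ (-H)`. These traces share a word of length `0.9 t₁`, and a common word has only one
source because `x` does not overlap itself there (`SecondStage.success`).

Apart from the top scale, whether a source location is bad depends only on bits and deletions within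
distance `O(log n)`, and its probability is at most `2 ^ (-0.3 H)` (`Regime.badNear_le`). Along a
residue class modulo twice that radius these events are independent, so with probability
`1 - 1 / (2 n ^ 2)` there are at most `2 ^ (-0.1 H) n` bad locations (`outcomeLaw_count_le`). A
location of the reference trace at which Align can fail has a bad source.
-/

namespace TraceAlign

/-! ### Counting survivors and deletions -/

/-- The number of surviving bits at source locations below `c`, that is, the `0`-based location in
the trace of the first surviving bit at or after `c`. -/
def keptBefore {n : ℕ} (D : Deletions n) (c : ℕ) : ℕ :=
  (Finset.univ.filter fun i : Fin n => (i : ℕ) < c ∧ D i = false).card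

/-- The number of deleted bits with source location in `[a, b)`. -/
def delIn {n : ℕ} (D : Deletions n) (a b : ℕ) : ℕ :=
  (Finset.univ.filter fun i : Fin n => a ≤ (i : ℕ) ∧ (i : ℕ) < b ∧ D i = true).card

/-- The surviving source locations in `[a, b)`, in increasing order. -/
def keptIn {n : ℕ} (D : Deletions n) (a b : ℕ) : List (Fin n) :=
  (List.finRange n).filter fun i => decide (a ≤ (i : ℕ)) && decide ((i : ℕ) < b) && !(D i)

theorem card_window {n : ℕ} (a b : ℕ) (hb : b ≤ n) :
    (Finset.univ.filter fun i : Fin n => a ≤ (i : ℕ) ∧ (i : ℕ) < b).card = b - a := by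
  rw [← Nat.card_Ico, ← Finset.card_map Fin.valEmbedding]
  congr 1
  ext i
  simp only [Finset.mem_map, Finset.mem_filter, Finset.mem_univ, true_and, Fin.valEmbedding_apply,
    Finset.mem_Ico]
  constructor
  · rintro ⟨k, hk, rfl⟩
    exact hk
  · intro hi
    exact ⟨⟨i, by omega⟩, hi, rfl⟩

theorem card_window_le {n : ℕ} (a b : ℕ) :
    (Finset.univ.filter fun i : Fin n => a ≤ (i : ℕ) ∧ (i : ℕ) < b).card ≤ b - a := by
  rw [← Nat.card_Ico, ← Finset.card_map Fin.valEmbedding]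
  refine Finset.card_le_card fun i => ?_
  simp only [Finset.mem_map, Finset.mem_filter, Finset.mem_univ, true_and, Fin.valEmbedding_apply,
    Finset.mem_Ico]
  rintro ⟨k, hk, rfl⟩
  exact hk

variable {n : ℕ}

theorem keptBefore_eq_add {D : Deletions n} {a b : ℕ} (hab : a ≤ b) :
    keptBefore D b = keptBefore D a +
      (Finset.univ.filter fun i : Fin n => a ≤ (i : ℕ) ∧ (i : ℕ) < b ∧ D i = false).card := by
  unfold keptBefore
  rw [← Finset.card_union_of_disjoint]
  · congr 1
    ext i
    simp only [Finset.mem_filter, Finset.mem_univ, true_and, Finset.mem_union]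
    grind
  · rw [Finset.disjoint_left]
    intro i
    simp only [Finset.mem_filter, Finset.mem_univ, true_and]
    omega

theorem keptBefore_mono (D : Deletions n) {a b : ℕ} (hab : a ≤ b) :
    keptBefore D a ≤ keptBefore D b := by
  rw [keptBefore_eq_add hab]
  omega

theorem keptBefore_le_add (D : Deletions n) {a b : ℕ} (hab : a ≤ b) :
    keptBefore D b ≤ keptBefore D a + (b - a) := by
  rw [keptBefore_eq_add hab]
  refine Nat.add_le_add_left (le_trans (Finset.card_le_card ?_) (card_window_le a b)) _
  intro i
  simp only [Finset.mem_filter, Finset.mem_univ, true_and]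
  tauto

theorem keptBefore_add_delIn (D : Deletions n) {a b : ℕ} (hab : a ≤ b) (hb : b ≤ n) :
    keptBefore D b + delIn D a b = keptBefore D a + (b - a) := by
  rw [keptBefore_eq_add hab, ← card_window a b hb, delIn, add_assoc,
    ← Finset.card_union_of_disjoint]
  · congr 2
    ext i
    simp only [Finset.mem_filter, Finset.mem_univ, true_and, Finset.mem_union]
    cases D i <;> simp
  · rw [Finset.disjoint_left]
    intro i
    simp only [Finset.mem_filter, Finset.mem_univ, true_and]
    rintro ⟨_, _, h⟩ ⟨_, _, h'⟩
    simp [h] at h'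

theorem delIn_mono (D : Deletions n) {a b a' b' : ℕ} (ha : a' ≤ a) (hb : b ≤ b') :
    delIn D a b ≤ delIn D a' b' := by
  refine Finset.card_le_card fun i => ?_
  simp only [Finset.mem_filter, Finset.mem_univ, true_and]
  rintro ⟨h1, h2, h3⟩
  exact ⟨by omega, by omega, h3⟩

theorem keptBefore_succ {D : Deletions n} {i : Fin n} (hi : D i = false) :
    keptBefore D (i + 1) = keptBefore D i + 1 := by
  have h := keptBefore_add_delIn D (Nat.le_add_right (i : ℕ) 1) i.isLt
  have h0 : delIn D i (i + 1) = 0 := by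
    unfold delIn
    rw [Finset.card_eq_zero, Finset.filter_eq_empty_iff]
    intro k _ ⟨h1, h2, h3⟩
    obtain rfl : k = i := Fin.ext (by omega)
    simp [hi] at h3
  omega

/-! ### Traces as lists -/

theorem kept_pairwise (D : Deletions n) : (kept D).Pairwise (· < ·) :=
  (List.pairwise_lt_finRange n).filter _

theorem keptIn_pairwise (D : Deletions n) (a b : ℕ) : (keptIn D a b).Pairwise (· < ·) :=
  (List.pairwise_lt_finRange n).filter _

theorem mem_kept {D : Deletions n} {i : Fin n} : i ∈ kept D ↔ D i = false := by
  simp [kept]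

theorem mem_keptIn {D : Deletions n} {a b : ℕ} {i : Fin n} :
    i ∈ keptIn D a b ↔ a ≤ (i : ℕ) ∧ (i : ℕ) < b ∧ D i = false := by
  simp [keptIn, and_assoc]

theorem keptBefore_getElem (D : Deletions n) (q : ℕ) (hq : q < (kept D).length) :
    keptBefore D ((kept D)[q] : Fin n) = q := by
  have hmono : StrictMono fun k : Fin (kept D).length => (kept D)[k] := by
    intro a b hab
    exact List.pairwise_iff_getElem.1 (kept_pairwise D) a b a.2 b.2 hab
  have himg : (Finset.univ.filter fun i : Fin n => (i : ℕ) < ((kept D)[q] : Fin n) ∧ D i = false)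
      = (Finset.Iio (⟨q, hq⟩ : Fin (kept D).length)).image fun k => (kept D)[k] := by
    ext i
    simp only [Finset.mem_filter, Finset.mem_univ, true_and, Finset.mem_image, Finset.mem_Iio]
    constructor
    · rintro ⟨h1, h2⟩
      obtain ⟨k, hk, rfl⟩ := List.getElem_of_mem (mem_kept.2 h2)
      have h3 : (⟨k, hk⟩ : Fin (kept D).length) < ⟨q, hq⟩ := hmono.lt_iff_lt.1 h1
      exact ⟨⟨k, hk⟩, h3, rfl⟩
    · rintro ⟨k, hk, rfl⟩
      exact ⟨hmono hk, mem_kept.1 (List.getElem_mem _)⟩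
  unfold keptBefore
  rw [himg, Finset.card_image_of_injective _ hmono.injective, Fin.card_Iio]

/-- The bit at the `0`-based location `q` of the trace comes from `i` if and only if `i` survives
and `q` survivors precede it. -/
theorem kept_getElem?_eq_some {D : Deletions n} {q : ℕ} {i : Fin n} :
    (kept D)[q]? = some i ↔ D i = false ∧ keptBefore D i = q := by
  constructor
  · intro h
    obtain ⟨hq, rfl⟩ := List.getElem?_eq_some_iff.1 h
    exact ⟨mem_kept.1 (List.getElem_mem _), keptBefore_getElem D q hq⟩
  · rintro ⟨h1, rfl⟩
    obtain ⟨k, hk, rfl⟩ := List.getElem_of_mem (mem_kept.2 h1)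
    rw [keptBefore_getElem D k hk]
    exact List.getElem?_eq_getElem hk

theorem isSource_iff {D : Deletions n} {q : ℕ} {i : Fin n} :
    IsSource D q i ↔ D i = false ∧ keptBefore D i + 1 = q := by
  unfold IsSource
  rw [kept_getElem?_eq_some]
  constructor
  · rintro ⟨h1, h2, h3⟩
    exact ⟨h2, by omega⟩
  · rintro ⟨h1, h2⟩
    exact ⟨by omega, h1, by omega⟩

theorem length_kept (D : Deletions n) : (kept D).length = keptBefore D n := by
  have hnd : (kept D).Nodup := (kept_pairwise D).imp fun h => ne_of_lt h
  rw [← List.toFinset_card_of_nodup hnd]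
  unfold keptBefore
  congr 1
  ext i
  simp [mem_kept]

theorem length_trace (x : Fin n → Bool) (D : Deletions n) :
    (trace x D).length = keptBefore D n := by
  rw [trace, List.length_map, length_kept]

theorem exists_source {D : Deletions n} {q : ℕ} (h1 : 1 ≤ q) (h2 : q ≤ keptBefore D n) :
    ∃ i : Fin n, D i = false ∧ keptBefore D i + 1 = q := by
  have hq : q - 1 < (kept D).length := by rw [length_kept]; omega
  refine ⟨(kept D)[q - 1], mem_kept.1 (List.getElem_mem _), ?_⟩
  rw [keptBefore_getElem]
  omega

theorem lt_of_keptBefore_lt {D : Deletions n} {a b : ℕ} (h : keptBefore D a < keptBefore D b) :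
    a < b := by
  by_contra hab
  have := keptBefore_mono D (not_lt.1 hab)
  omega

theorem keptBefore_lt {D : Deletions n} {i : Fin n} {b : ℕ} (hi : D i = false) (h : (i : ℕ) < b) :
    keptBefore D i < keptBefore D b := by
  have h1 := keptBefore_succ hi
  have h2 := keptBefore_mono D (show (i : ℕ) + 1 ≤ b from h)
  omega

theorem eq_of_pairwise_lt {l l' : List (Fin n)} (h : l.Pairwise (· < ·))
    (h' : l'.Pairwise (· < ·)) (hm : ∀ i, i ∈ l ↔ i ∈ l') : l = l' := by
  have hp : l.Perm l' := (List.perm_ext_iff_of_nodup (h.imp fun h => ne_of_lt h)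
    (h'.imp fun h => ne_of_lt h)).2 hm
  exact hp.eq_of_pairwise (fun a b _ _ h1 h2 => absurd h1 (not_lt.2 h2.le)) h h'

theorem mem_drop_take_kept {D : Deletions n} {u v : ℕ} {i : Fin n} :
    i ∈ ((kept D).drop u).take v ↔
      D i = false ∧ u ≤ keptBefore D i ∧ keptBefore D i < u + v := by
  rw [List.mem_iff_getElem?]
  constructor
  · rintro ⟨k, hk⟩
    rw [List.getElem?_take] at hk
    split_ifs at hk with hkv
    rw [List.getElem?_drop, kept_getElem?_eq_some] at hk
    exact ⟨hk.1, by omega, by omega⟩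
  · rintro ⟨h1, h2, h3⟩
    refine ⟨keptBefore D i - u, ?_⟩
    rw [List.getElem?_take, if_pos (by omega), List.getElem?_drop, kept_getElem?_eq_some]
    exact ⟨h1, by omega⟩

theorem drop_take_kept_pairwise (D : Deletions n) (u v : ℕ) :
    (((kept D).drop u).take v).Pairwise (· < ·) :=
  ((kept_pairwise D).sublist (List.drop_sublist _ _)).sublist (List.take_sublist _ _)

theorem keptIn_eq_drop_take (D : Deletions n) {a b : ℕ} (hab : a ≤ b) :
    keptIn D a b = ((kept D).drop (keptBefore D a)).take (keptBefore D b - keptBefore D a) := by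
  refine eq_of_pairwise_lt (keptIn_pairwise D a b) (drop_take_kept_pairwise D _ _) fun i => ?_
  rw [mem_keptIn, mem_drop_take_kept]
  have hm := keptBefore_mono D hab
  constructor
  · rintro ⟨h1, h2, h3⟩
    have := keptBefore_mono D h1
    have := keptBefore_lt h3 h2
    exact ⟨h3, by omega, by omega⟩
  · rintro ⟨h1, h2, h3⟩
    refine ⟨?_, ?_, h1⟩
    · by_contra hc
      have := keptBefore_lt h1 (not_le.1 hc)
      omega
    · exact lt_of_keptBefore_lt (D := D) (by omega)

theorem subword_trace (x : Fin n → Bool) (D : Deletions n) (Q : ℕ × ℕ) :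
    subword (trace x D) Q = (((kept D).drop (Q.1 - 1)).take (Q.2 + 1 - Q.1)).map x := by
  rw [subword, trace, ← List.map_drop, ← List.map_take]

theorem length_subword_trace (x : Fin n → Bool) (D : Deletions n) {Q : ℕ × ℕ} (h1 : 1 ≤ Q.1)
    (h2 : Q.2 ≤ keptBefore D n) : (subword (trace x D) Q).length = Q.2 + 1 - Q.1 := by
  rw [subword, List.length_take, List.length_drop, length_trace]
  omega

/-! ### Common subsequences -/

theorem bddAbove_common (u v : List Bool) :
    BddAbove {k | ∃ z : List Bool, z.Sublist u ∧ z.Sublist v ∧ z.length = k} := by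
  refine ⟨u.length, ?_⟩
  rintro k ⟨z, hz, -, rfl⟩
  exact hz.length_le

theorem length_le_lcsLength {z u v : List Bool} (h1 : z.Sublist u) (h2 : z.Sublist v) :
    z.length ≤ lcsLength u v :=
  le_csSup (bddAbove_common u v) ⟨z, h1, h2, rfl⟩

theorem exists_lcs (u v : List Bool) :
    ∃ z : List Bool, z.Sublist u ∧ z.Sublist v ∧ z.length = lcsLength u v :=
  Nat.sSup_mem (s := {k | ∃ z : List Bool, z.Sublist u ∧ z.Sublist v ∧ z.length = k})
    ⟨0, [], List.nil_sublist _, List.nil_sublist _, rfl⟩ (bddAbove_common u v)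

theorem add_le_orderEmb {k m : ℕ} (f : Fin k ↪o Fin m) (r : Fin k) :
    (r : ℕ) ≤ f r ∧ (f r : ℕ) + k ≤ m + r := by
  have h : ∀ d (a b : Fin k), (a : ℕ) + d = b → (f a : ℕ) + d ≤ f b := by
    intro d
    induction d with
    | zero =>
      intro a b hab
      obtain rfl : a = b := Fin.ext hab
      simp
    | succ d ih =>
      intro a b hab
      have h1 := ih a ⟨a + d, by omega⟩ rfl
      have h2 : f ⟨a + d, by omega⟩ < f b := f.lt_iff_lt.2 (Fin.lt_def.2 (by simp; omega))
      have h3 := Fin.lt_def.1 h2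
      omega
  have hk := r.2
  have h0 := h r ⟨0, by omega⟩ r (by simp)
  have h1 := h (k - 1 - r) r ⟨k - 1, by omega⟩ (by simp; omega)
  have h2 := (f ⟨k - 1, by omega⟩).2
  constructor <;> omega

/-- A common subsequence of length `k` of two subwords of traces pairs off source locations
`f r` and `g r`, `r < k`. The number of letters of the first subword before `f r` lies between `r`
and `r` plus the number of its unmatched letters; the same holds for `g r` and the second
subword. -/
theorem exists_alignment {x : Fin n → Bool} {D D' : Deletions n} {Q Q' : ℕ × ℕ} {k : ℕ}
    {z : List Bool} (hQ : 1 ≤ Q.1) (hQn : Q.2 ≤ keptBefore D n)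
    (hQ' : 1 ≤ Q'.1) (hQn' : Q'.2 ≤ keptBefore D' n)
    (h1 : z.Sublist (subword (trace x D) Q)) (h2 : z.Sublist (subword (trace x D') Q'))
    (hk : z.length = k) :
    ∃ f g : Fin k → Fin n, StrictMono f ∧ StrictMono g ∧
      ∀ r : Fin k, x (f r) = x (g r) ∧
        D (f r) = false ∧ Q.1 + r ≤ keptBefore D (f r) + 1 ∧
          keptBefore D (f r) + k + 1 ≤ Q.2 + 1 + r ∧
        D' (g r) = false ∧ Q'.1 + r ≤ keptBefore D' (g r) + 1 ∧
          keptBefore D' (g r) + k + 1 ≤ Q'.2 + 1 + r := by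
  have key : ∀ (D : Deletions n) (Q : ℕ × ℕ), 1 ≤ Q.1 → Q.2 ≤ keptBefore D n →
      z.Sublist (subword (trace x D) Q) → ∃ f : Fin k → Fin n, StrictMono f ∧
        ∀ r : Fin k, some (x (f r)) = z[(r : ℕ)]? ∧ D (f r) = false ∧
          Q.1 + r ≤ keptBefore D (f r) + 1 ∧ keptBefore D (f r) + k + 1 ≤ Q.2 + 1 + r := by
    intro D Q hQ hQn hz
    have hlen := length_subword_trace x D hQ hQn
    rw [subword_trace] at hz hlen
    rw [List.length_map] at hlen
    obtain ⟨l, hl, rfl⟩ := List.sublist_map_iff.1 hz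
    rw [List.length_map] at hk
    subst hk
    obtain ⟨e, he⟩ := List.sublist_iff_exists_fin_orderEmbedding_get_eq.1 hl
    refine ⟨fun r => l.get r, ?_, fun r => ?_⟩
    · intro a b hab
      exact List.pairwise_iff_getElem.1 ((drop_take_kept_pairwise D _ _).sublist hl) a b a.2 b.2 hab
    · have hmem : l.get r ∈ ((kept D).drop (Q.1 - 1)).take (Q.2 + 1 - Q.1) :=
        hl.subset (List.get_mem _ _)
      have hD := (mem_drop_take_kept.1 hmem).1
      have hidx : keptBefore D (l.get r) = Q.1 - 1 + (e r : ℕ) := by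
        rw [he r]
        have h3 := (e r).2
        have h4 : (((kept D).drop (Q.1 - 1)).take (Q.2 + 1 - Q.1))[(e r : ℕ)]? =
            some ((((kept D).drop (Q.1 - 1)).take (Q.2 + 1 - Q.1)).get (e r)) :=
          List.getElem?_eq_getElem (e r).2
        rw [List.getElem?_take, if_pos (by omega), List.getElem?_drop,
          kept_getElem?_eq_some] at h4
        exact h4.2
      have h5 := add_le_orderEmb e r
      have h6 := r.2
      refine ⟨by simp, hD, ?_, ?_⟩ <;> dsimp only at * <;> omega
  obtain ⟨f, hf, hf'⟩ := key D Q hQ hQn h1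
  obtain ⟨g, hg, hg'⟩ := key D' Q' hQ' hQn' h2
  refine ⟨f, g, hf, hg, fun r => ?_⟩
  obtain ⟨a1, a2, a3, a4⟩ := hf' r
  obtain ⟨b1, b2, b3, b4⟩ := hg' r
  exact ⟨by simpa using a1.trans b1.symm, a2, a3, a4, b2, b3, b4⟩

/-! ### Narrowing at one scale -/

/-- The pattern `D` has at most `t / 400` deletions in each window of length `4 t` that starts in
`[lo, hi)`. -/
def Sparse (D : Deletions n) (t lo hi : ℕ) : Prop :=
  ∀ c, lo ≤ c → c < hi → 400 * delIn D c (c + 4 * t) ≤ t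

/-- `x` nearly repeats itself at scale `t`: a window of length about `t` around `j` and a window of
length about `t` that starts in `[lo, hi)` have a common subsequence of length `0.98 t` none of whose
letters sits at the same location in both. -/
def Repeats (x : Fin n → Bool) (t j lo hi : ℕ) : Prop :=
  ∃ c, lo ≤ c ∧ c < hi ∧ ∃ f g : Fin (t - t / 50) → Fin n, StrictMono f ∧ StrictMono g ∧
    ∀ r, (j - (t / 2 + t / 400) ≤ (f r : ℕ) ∧ (f r : ℕ) < j - (t / 2 + t / 400) + (t + t / 40)) ∧
      (c ≤ (g r : ℕ) ∧ (g r : ℕ) < c + (t + t / 40)) ∧ f r ≠ g r ∧ x (f r) = x (g r)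

/-- The interval `Q` of locations in the trace contains only bits from the source window `[lo, hi)`,
and all surviving bits from the source window `[a, b)`. -/
structure Locates (D : Deletions n) (Q : ℕ × ℕ) (lo hi a b : ℕ) : Prop where
  one_le : 1 ≤ Q.1
  le_length : Q.2 ≤ keptBefore D n
  source_mem : ∀ i : Fin n, D i = false → Q.1 ≤ keptBefore D i + 1 → keptBefore D i + 1 ≤ Q.2 →
    lo ≤ (i : ℕ) ∧ (i : ℕ) < hi
  mem_of_source : ∀ i : Fin n, D i = false → a ≤ (i : ℕ) → (i : ℕ) < b →
    Q.1 ≤ keptBefore D i + 1 ∧ keptBefore D i + 1 ≤ Q.2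

theorem Locates.mono {D : Deletions n} {Q : ℕ × ℕ} {lo hi a b lo' hi' a' b' : ℕ}
    (h : Locates D Q lo hi a b) (h1 : lo' ≤ lo) (h2 : hi ≤ hi') (h3 : a ≤ a') (h4 : b' ≤ b) :
    Locates D Q lo' hi' a' b' := by
  refine ⟨h.one_le, h.le_length, fun i hi h5 h6 => ?_, fun i hi h5 h6 => ?_⟩
  · have := h.source_mem i hi h5 h6
    omega
  · exact h.mem_of_source i hi (by omega) (by omega)

theorem locates_univ (D : Deletions n) (a b : ℕ) :
    Locates D (1, keptBefore D n) 0 n a b := by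
  refine ⟨le_rfl, le_rfl, fun i _ _ _ => ⟨Nat.zero_le _, i.isLt⟩, fun i hi _ _ => ⟨by simp, ?_⟩⟩
  have := keptBefore_lt hi i.isLt
  simp only
  omega

/-- In a window with few deletions, source distances exceed trace distances by little. -/
theorem Sparse.source_le {D : Deletions n} {t lo hi a b : ℕ} (h : Sparse D t lo hi) (ht : 0 < t)
    (h1 : lo ≤ a) (h2 : a < hi) (hab : a ≤ b) (hb : b ≤ n)
    (hk : keptBefore D b ≤ keptBefore D a + 2 * t) :
    400 * (b + keptBefore D a) ≤ 400 * (a + keptBefore D b) + t := by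
  have h3 := h a h1 h2
  rcases le_total b (a + 4 * t) with hb' | hb'
  · have h4 := keptBefore_add_delIn D hab hb
    have h5 := delIn_mono D (le_refl a) hb'
    omega
  · have h4 := keptBefore_add_delIn D (Nat.le_add_right a (4 * t)) (by omega)
    have h5 := keptBefore_mono D hb'
    omega

section Window

variable {D : Deletions n} {t u l lo hi : ℕ} {j : Fin n}

/-- Source locations of the bits in a reference window of length `t = 2 u + 1` centred at `j`. -/
theorem window_source (ht : t = 2 * u + 1) (hs : Sparse D t lo hi)
    (hlo : lo ≤ j - t) (hhi : min (j + t) n ≤ hi) (hj : keptBefore D j + 1 = l) {i : Fin n}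
    (h1 : l ≤ keptBefore D i + 1 + u) (h2 : keptBefore D i + 1 ≤ l + u) :
    400 * ((j : ℕ) + keptBefore D i) ≤ 400 * (i + keptBefore D j) + t ∧
      400 * ((i : ℕ) + keptBefore D j) ≤ 400 * (j + keptBefore D i) + t := by
  have hjn := j.isLt
  have hin := i.isLt
  rcases le_total (i : ℕ) j with hij | hij
  · have h3 := keptBefore_le_add D hij
    refine ⟨?_, by omega⟩
    by_cases hti : (i : ℕ) < j - t
    · have h4 := hs.source_le (a := j - t) (b := j) (by omega) (by omega) (by omega) (by omega)
        (by omega) (by have := keptBefore_mono D hti.le; omega)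
      have := keptBefore_mono D hti.le
      omega
    · exact hs.source_le (by omega) (by omega) (by omega) hij (by omega) (by omega)
  · have h3 := keptBefore_le_add D hij
    refine ⟨by omega, ?_⟩
    exact hs.source_le (by omega) (by omega) (by omega) hij (by omega) (by omega)

end Window

section Step

variable {x : Fin n → Bool} {D E : Deletions n} {t u l lo hi a b : ℕ} {j : Fin n} {Q Q' : ℕ × ℕ}

/-- If `x` does not nearly repeat itself at scale `t`, then every subword of a trace that is
close to the reference window comes from about the same source window: an alignment of
the two must match some bit with itself, and this pins down the offset. -/
theorem locates_of_match (ht : t = 2 * u + 1) (htl : 4000 ≤ t) (hsE : Sparse E t lo hi)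
    (hsD : Sparse D t lo hi) (hrep : ¬ Repeats x t j lo hi)
    (hlo : lo ≤ j - t) (hhi : min (j + t) n ≤ hi)
    (hj : keptBefore E j + 1 = l) (hl1 : u + 1 ≤ l) (hl2 : l + u ≤ keptBefore E n)
    (hQ : Locates D Q lo hi a b) (h1 : Q.1 ≤ Q'.1) (h2 : Q'.1 ≤ Q'.2) (h3 : Q'.2 ≤ Q.2)
    (hed : 50 * editDist (subword (trace x E) (l - u, l + u)) (subword (trace x D) Q') ≤ t) :
    Locates D Q' (j - 21 * t / 40) (j + 21 * t / 40 + 1) (j - 47 * t / 100)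
      (j + 47 * t / 100 + 1) := by
  have hQ1 := hQ.one_le
  have hQ2 := hQ.le_length
  obtain ⟨z, hz1, hz2, hz3⟩ := exists_lcs (subword (trace x E) (l - u, l + u))
    (subword (trace x D) Q')
  have hlen1 := hz1.length_le
  have hlen2 := hz2.length_le
  rw [editDist, ← hz3] at hed
  rw [length_subword_trace x E (Q := (l - u, l + u)) (by simp; omega) hl2] at hed hlen1
  rw [length_subword_trace x D (Q := Q') (by omega) (by omega)] at hed hlen2
  dsimp only at hed hlen1
  obtain ⟨k, hk⟩ : ∃ k, z.length = k := ⟨_, rfl⟩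
  rw [hk] at hed hlen1 hlen2
  obtain ⟨f, g, hf, hg, hfg⟩ := exists_alignment (Q := (l - u, l + u)) (Q' := Q') (by simp; omega)
    hl2 (by omega) (by omega) hz1 hz2 hk
  dsimp only at hfg
  obtain ⟨q, hq⟩ : ∃ q, q = Q'.2 + 1 - Q'.1 := ⟨_, rfl⟩
  rw [← hq] at hed hlen2
  -- The bit at which `Q'` starts locates the window of the matched bits.
  obtain ⟨c, hc, hcQ⟩ := exists_source (D := D) (q := Q'.1) (by omega) (by omega)
  have hcm := hQ.source_mem c hc (by omega) (by omega)
  have hmem : ∀ i : Fin n, D i = false → Q'.1 ≤ keptBefore D i + 1 → keptBefore D i + 1 ≤ Q'.2 →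
      lo ≤ (i : ℕ) ∧ (i : ℕ) < hi := fun i hi h4 h5 =>
    hQ.source_mem i hi (by omega) (by omega)
  have hkt : t - t / 50 ≤ k := by omega
  obtain ⟨r, hr⟩ : ∃ r, f r = g r := by
    by_contra hne
    push Not at hne
    refine hrep ⟨c, hcm.1, hcm.2, fun r => f (Fin.castLE hkt r), fun r => g (Fin.castLE hkt r),
      hf.comp (Fin.strictMono_castLE hkt), hg.comp (Fin.strictMono_castLE hkt), fun r => ?_⟩
    obtain ⟨e1, e2, e3, e4, e5, e6, e7⟩ := hfg (Fin.castLE hkt r)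
    have hr := r.2
    have hcast : ((Fin.castLE hkt r : Fin k) : ℕ) = r := rfl
    rw [hcast] at e3 e4 e6 e7
    refine ⟨?_, ?_, hne _, e1⟩ <;> dsimp only
    · have := window_source ht hsE hlo hhi hj (i := f (Fin.castLE hkt r)) (by omega) (by omega)
      omega
    · have hcg : (c : ℕ) ≤ g (Fin.castLE hkt r) := by
        by_contra hlt
        have := keptBefore_lt e5 (not_le.1 hlt)
        omega
      refine ⟨hcg, ?_⟩
      have := hsD.source_le (by omega) hcm.1 hcm.2 hcg (g (Fin.castLE hkt r)).isLt.le (by omega)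
      omega
  obtain ⟨-, e2, e3, e4, e5, e6, e7⟩ := hfg r
  rw [← hr] at e5 e6 e7
  generalize f r = p at *
  have hp := window_source ht hsE hlo hhi hj (i := p) (by omega) (by omega)
  have hpm := hmem p e5 (by omega) (by omega)
  have hpn := p.isLt
  have hrk := r.2
  refine ⟨by omega, by omega, fun i hi h4 h5 => ?_, fun i hi h4 h5 => ?_⟩
  · have him := hmem i hi h4 h5
    have hin := i.isLt
    rcases le_total (i : ℕ) p with hip | hip
    · have := hsD.source_le (by omega) him.1 him.2 hip hpn.le (by omega)
      have := keptBefore_mono D hip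
      omega
    · have := hsD.source_le (by omega) hpm.1 hpm.2 hip hin.le (by omega)
      have := keptBefore_mono D hip
      omega
  · rcases le_total (i : ℕ) p with hip | hip
    · have := keptBefore_le_add D hip
      have := keptBefore_mono D hip
      omega
    · have := keptBefore_le_add D hip
      have := keptBefore_mono D hip
      omega

/-- The surviving bits of the source window of the reference window are a suitable match. -/
theorem exists_match (ht : t = 2 * u + 1) (htl : 4000 ≤ t) (hsE : Sparse E t lo hi)
    (hsD : Sparse D t lo hi) (hlo : lo ≤ j - t) (hhi : min (j + t) n ≤ hi)
    (hj : keptBefore E j + 1 = l) (hl1 : u + 1 ≤ l) (hl2 : l + u ≤ keptBefore E n)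
    (hQ : Locates D Q lo hi a b) (ha : a ≤ j - (t / 2 + t / 400))
    (hb : min (j + (t / 2 + t / 400) + 1) n ≤ b) :
    ∃ Q' : ℕ × ℕ, Q.1 ≤ Q'.1 ∧ Q'.1 ≤ Q'.2 ∧ Q'.2 ≤ Q.2 ∧
      50 * editDist (subword (trace x E) (l - u, l + u)) (subword (trace x D) Q') ≤ t := by
  obtain ⟨p, hp, hpl⟩ := exists_source (D := E) (q := l - u) (by omega) (by omega)
  obtain ⟨q, hq, hql⟩ := exists_source (D := E) (q := l + u) (by omega) (by omega)
  have hp1 := window_source ht hsE hlo hhi hj (i := p) (by omega) (by omega)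
  have hq1 := window_source ht hsE hlo hhi hj (i := q) (by omega) (by omega)
  have hqs := keptBefore_succ hq
  have hpn := p.isLt
  have hqn := q.isLt
  have hpq : (p : ℕ) ≤ q + 1 := by
    have := lt_of_keptBefore_lt (D := E) (a := p) (b := q + 1) (by omega)
    omega
  -- Deletions between `p` and `q` are few in both patterns.
  have hlen := keptBefore_add_delIn E hpq (by omega)
  have hlenD := keptBefore_add_delIn D hpq (by omega)
  have hsub : q + 1 ≤ p + 4 * t := by omega
  have hdE := (Nat.mul_le_mul_left 400 (delIn_mono E (le_refl (p : ℕ)) hsub)).trans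
    (hsE p (by omega) (by omega))
  have hdD := (Nat.mul_le_mul_left 400 (delIn_mono D (le_refl (p : ℕ)) hsub)).trans
    (hsD p (by omega) (by omega))
  set w := (List.finRange n).filter
    fun i : Fin n => decide ((p : ℕ) ≤ (i : ℕ)) && decide ((i : ℕ) < q + 1) && !(E i) && !(D i)
    with hw
  have hsubE : w.Sublist (keptIn E p (q + 1)) :=
    List.monotone_filter_right _ fun i => by
      cases D i <;> simp
  have hsubD : w.Sublist (keptIn D p (q + 1)) :=
    List.monotone_filter_right _ fun i => by
      cases E i <;> simp
  have hE1 : (subword (trace x E) (l - u, l + u)) = (keptIn E p (q + 1)).map x := by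
    rw [subword_trace, keptIn_eq_drop_take E hpq]
    have e1 : l - u - 1 = keptBefore E p := by omega
    have e2 : l + u + 1 - (l - u) = keptBefore E (q + 1) - keptBefore E p := by omega
    simp only [e1, e2]
  have hD1 : (subword (trace x D) (keptBefore D p + 1, keptBefore D (q + 1))) =
      (keptIn D p (q + 1)).map x := by
    rw [subword_trace, keptIn_eq_drop_take D hpq]
    simp
  have hlE : (keptIn E p (q + 1)).length + keptBefore E p = keptBefore E (q + 1) := by
    rw [keptIn_eq_drop_take E hpq, List.length_take, List.length_drop, length_kept]
    have := keptBefore_mono E (show (q : ℕ) + 1 ≤ n by omega)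
    have := keptBefore_mono E hpq
    omega
  have hlD : (keptIn D p (q + 1)).length + keptBefore D p = keptBefore D (q + 1) := by
    rw [keptIn_eq_drop_take D hpq, List.length_take, List.length_drop, length_kept]
    have := keptBefore_mono D (show (q : ℕ) + 1 ≤ n by omega)
    have := keptBefore_mono D hpq
    omega
  have hcommon : ∀ D E : Deletions n, (keptIn E p (q + 1)).length ≤
      ((List.finRange n).filter fun i : Fin n => decide ((p : ℕ) ≤ (i : ℕ)) && decide ((i : ℕ) < q + 1) &&
        !(E i) && !(D i)).length + delIn D p (q + 1) := by
    intro D E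
    have hnd : ∀ s : Fin n → Bool, ((List.finRange n).filter s).length =
        (Finset.univ.filter fun i => s i = true).card := by
      intro s
      rw [← List.toFinset_card_of_nodup ((List.nodup_finRange n).filter s)]
      congr 1
      ext i
      simp
    rw [keptIn, hnd, hnd, delIn]
    refine le_trans (Finset.card_le_card ?_) (Finset.card_union_le _ _)
    intro i
    simp only [Finset.mem_filter, Finset.mem_univ, true_and, Finset.mem_union]
    cases D i <;> cases E i <;> simp
  have hc1 := hcommon D E
  have hc2 := hcommon E D
  rw [← hw] at hc1
  have hw' : w = (List.finRange n).filter fun i : Fin n => decide ((p : ℕ) ≤ (i : ℕ)) &&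
      decide ((i : ℕ) < q + 1) && !(D i) && !(E i) := by
    rw [hw]
    congr 1
    funext i
    rw [Bool.and_assoc, Bool.and_assoc, Bool.and_comm (!(E i)), ← Bool.and_assoc, ← Bool.and_assoc]
  rw [← hw'] at hc2
  have hlcs := length_le_lcsLength (hsubE.map x) (hsubD.map x)
  rw [List.length_map] at hlcs
  have hne : keptBefore D p < keptBefore D (q + 1) := by omega
  have hqle := keptBefore_mono D (show (q : ℕ) + 1 ≤ n by omega)
  refine ⟨(keptBefore D p + 1, keptBefore D (q + 1)), ?_, hne, ?_, ?_⟩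
  · obtain ⟨i, hi, hil⟩ := exists_source (D := D) (q := keptBefore D p + 1) (by omega) (by omega)
    have hpi : (p : ℕ) ≤ i := by
      by_contra hlt
      have := keptBefore_lt hi (not_le.1 hlt)
      omega
    have hiq : (i : ℕ) < q + 1 := lt_of_keptBefore_lt (D := D) (by omega)
    have := hQ.mem_of_source i hi (by omega) (by omega)
    simp only
    omega
  · obtain ⟨i, hi, hil⟩ := exists_source (D := D) (q := keptBefore D (q + 1)) (by omega) (by omega)
    have hpi : (p : ℕ) ≤ i := by
      by_contra hlt
      have := keptBefore_lt hi (not_le.1 hlt)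
      omega
    have hiq : (i : ℕ) < q + 1 := lt_of_keptBefore_lt (D := D) (by omega)
    have := hQ.mem_of_source i hi (by omega) (by omega)
    simp only
    omega
  · rw [hE1, hD1, editDist, List.length_map, List.length_map]
    omega

end Step

variable {M : ℕ}

/-! ### The first stage -/

/-- Scale `t` is bad around `j`, for the area `[lo, hi)`: some trace has too many deletions in
a window that starts there, or `x` nearly repeats itself. -/
def BadLevel (x : Fin n → Bool) (E : Deletions n) (D : Fin M → Deletions n) (t j lo hi : ℕ) :
    Prop :=
  ¬ Sparse E t lo hi ∨ (∃ m, ¬ Sparse (D m) t lo hi) ∨ Repeats x t j lo hi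

theorem windowLen_one (h : ℕ) : windowLen h 1 = 2 * h + 1 := by
  simp [windowLen]

theorem windowLen_succ (h : ℕ) {s : ℕ} (hs : 1 ≤ s) : windowLen h (s + 1) = 3 * windowLen h s := by
  obtain ⟨s, rfl⟩ := Nat.exists_eq_add_of_le' hs
  simp only [windowLen, Nat.add_sub_cancel, pow_succ]
  ring

theorem windowLen_mono (h : ℕ) {s s' : ℕ} (hs : s ≤ s') : windowLen h s ≤ windowLen h s' := by
  unfold windowLen
  gcongr
  norm_num

theorem windowLen_odd (h s : ℕ) : windowLen h s = 2 * ((windowLen h s - 1) / 2) + 1 := by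
  have h1 : Odd (windowLen h s) := by
    unfold windowLen
    exact (Odd.pow (by decide)).mul ⟨h, rfl⟩
  obtain ⟨k, hk⟩ := h1
  omega

theorem match_iff (e t : ℕ) : ((e : ℝ) ≤ 2 * gammaC * t) ↔ 50 * e ≤ t := by
  rw [← Nat.cast_le (α := ℝ), gammaC]
  push_cast
  constructor <;> intro h <;> linarith

section Narrows

variable {x : Fin n → Bool} {E D : Deletions n} {h l s lo hi a b : ℕ} {j : Fin n} {Q : ℕ × ℕ}
  {r : Option (ℕ × ℕ)}

/-- The interval `Q` of a trace shows the source window of length about `t` around `j`, with a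
tolerance of about `0.03 t` at both ends. -/
def Focused (D : Deletions n) (Q : ℕ × ℕ) (t j : ℕ) : Prop :=
  Locates D Q (j - 21 * t / 40) (j + 21 * t / 40 + 1) (j - 47 * t / 100) (j + 47 * t / 100 + 1)

/-- One round of the first stage: it cannot get stuck, and it ends in a focused interval. -/
theorem Narrows.exists_focused (htl : 4000 ≤ windowLen h (s + 1))
    (hsE : Sparse E (windowLen h (s + 1)) lo hi) (hsD : Sparse D (windowLen h (s + 1)) lo hi)
    (hrep : ¬ Repeats x (windowLen h (s + 1)) j lo hi)
    (hlo : lo ≤ j - windowLen h (s + 1)) (hhi : min (j + windowLen h (s + 1)) n ≤ hi)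
    (hj : keptBefore E j + 1 = l) (hl1 : (windowLen h (s + 1) - 1) / 2 + 1 ≤ l)
    (hl2 : l + (windowLen h (s + 1) - 1) / 2 ≤ keptBefore E n)
    (hQ : Locates D Q lo hi a b)
    (ha : a ≤ j - (windowLen h (s + 1) / 2 + windowLen h (s + 1) / 400))
    (hb : min (j + (windowLen h (s + 1) / 2 + windowLen h (s + 1) / 400) + 1) n ≤ b)
    (hr : Narrows h l (trace x E) (trace x D) (s + 1) Q r) :
    ∃ Q', Focused D Q' (windowLen h (s + 1)) j ∧
      Narrows h l (trace x E) (trace x D) s Q' r := by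
  have hodd := windowLen_odd h (s + 1)
  cases hr with
  | step _ _ Q' _ hm hr =>
    obtain ⟨h1, h2, h3, h4⟩ := hm
    rw [match_iff] at h4
    exact ⟨Q', locates_of_match hodd htl hsE hsD hrep hlo hhi hj hl1 hl2 hQ h1 h2 h3 h4, hr⟩
  | stuck _ _ hno =>
    obtain ⟨Q', h1, h2, h3, h4⟩ := exists_match (x := x) hodd htl hsE hsD hlo hhi hj hl1 hl2 hQ
      ha hb
    exact absurd ⟨h1, h2, h3, (match_iff _ _).2 h4⟩ (hno Q')

/-- The rounds below the top scale, each of which starts inside a window found before. -/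
theorem Narrows.focused_of_local (htl : 4000 ≤ windowLen h 1)
    (hgood : ∀ s', 1 ≤ s' → s' ≤ s →
      Sparse E (windowLen h s') (j - 2 * windowLen h s') (j + 2 * windowLen h s') ∧
      Sparse D (windowLen h s') (j - 2 * windowLen h s') (j + 2 * windowLen h s') ∧
      ¬ Repeats x (windowLen h s') j (j - 2 * windowLen h s') (j + 2 * windowLen h s'))
    (hj : keptBefore E j + 1 = l) (hl1 : (windowLen h s - 1) / 2 + 1 ≤ l)
    (hl2 : l + (windowLen h s - 1) / 2 ≤ keptBefore E n)
    (hQ : Focused D Q (windowLen h (s + 1)) j)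
    (hr : Narrows h l (trace x E) (trace x D) s Q r) :
    ∃ Q', r = some Q' ∧ Focused D Q' (windowLen h 1) j := by
  induction s generalizing Q with
  | zero =>
    cases hr with
    | done => exact ⟨Q, rfl, hQ⟩
  | succ s ih =>
    obtain ⟨hE, hD, hrep⟩ := hgood (s + 1) (by omega) le_rfl
    have hmono := windowLen_mono h (show s ≤ s + 1 by omega)
    have hmono1 := windowLen_mono h (show 1 ≤ s + 1 by omega)
    unfold Focused at hQ
    rw [windowLen_succ h (show 1 ≤ s + 1 by omega)] at hQ
    obtain ⟨Q', hQ', hr'⟩ := Narrows.exists_focused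
      (by omega) hE hD hrep
      (by omega) (by omega) hj hl1 hl2
      (hQ.mono (by omega) (by omega) (le_refl _) (le_refl _)) (by omega) (by omega) hr
    exact ih (fun s' h1 h2 => hgood s' h1 (by omega)) (by omega) (by omega) hQ' hr'

end Narrows

/-! ### The second stage -/

/-- Two subwords of `x` of length `L` that start at different places of `[lo, hi)` agree. -/
def SelfOverlaps (x : Fin n → Bool) (L lo hi : ℕ) : Prop :=
  ∃ c c', (lo ≤ c ∧ c < hi) ∧ (lo ≤ c' ∧ c' < hi) ∧ c ≠ c' ∧ ∃ f g : Fin L → Fin n,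
    ∀ r, (f r : ℕ) = c + r ∧ (g r : ℕ) = c' + r ∧ x (f r) = x (g r)

/-- The traces with a deletion in the source window `[lo, hi)`. -/
def dirty (D : Fin M → Deletions n) (lo hi : ℕ) : Finset (Fin M) :=
  Finset.univ.filter fun m => 0 < delIn (D m) lo hi

section Clean

variable {x : Fin n → Bool} {D : Deletions n} {lo hi : ℕ}

theorem eq_false_of_delIn_eq_zero (h : delIn D lo hi = 0) {i : Fin n} (h1 : lo ≤ (i : ℕ))
    (h2 : (i : ℕ) < hi) : D i = false := by
  rw [delIn, Finset.card_eq_zero, Finset.filter_eq_empty_iff] at h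
  have := h (Finset.mem_univ i)
  simpa [h1, h2] using this

theorem keptBefore_of_delIn_eq_zero (h : delIn D lo hi = 0) {a b : ℕ} (h1 : lo ≤ a) (hab : a ≤ b)
    (h2 : b ≤ hi) (hb : b ≤ n) : keptBefore D b = keptBefore D a + (b - a) := by
  have h3 := keptBefore_add_delIn D hab hb
  have h4 := delIn_mono D h1 h2
  omega

theorem drop_take_trace_of_clean (h : delIn D lo hi = 0) {a L : ℕ} (h1 : lo ≤ a) (h2 : a + L ≤ hi)
    (hb : a + L ≤ n) : ((trace x D).drop (keptBefore D a)).take L =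
      (keptIn (fun _ => false) a (a + L)).map x := by
  have h3 : keptIn (fun _ : Fin n => false) a (a + L) = keptIn D a (a + L) := by
    refine eq_of_pairwise_lt (keptIn_pairwise _ _ _) (keptIn_pairwise _ _ _) fun i => ?_
    rw [mem_keptIn, mem_keptIn]
    constructor
    · rintro ⟨h4, h5, -⟩
      exact ⟨h4, h5, eq_false_of_delIn_eq_zero h (by omega) (by omega)⟩
    · rintro ⟨h4, h5, -⟩
      exact ⟨h4, h5, rfl⟩
  have h4 := keptBefore_of_delIn_eq_zero h h1 (Nat.le_add_right a L) h2 hb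
  rw [h3, keptIn_eq_drop_take D (Nat.le_add_right a L), trace, ← List.map_drop, ← List.map_take, h4]
  congr 2
  omega

/-- Where a word occurs in a trace without deletions nearby, it is a subword of `x`. -/
theorem exists_source_of_occursAt (h : delIn D lo hi = 0) {Q : ℕ × ℕ} {a b a' b' p : ℕ}
    {w : List Bool} (hQ : Locates D Q a b a' b') (ha : lo ≤ a) (hb : b ≤ hi)
    (hw : OccursAt w (trace x D) Q p) (hw0 : 0 < w.length) :
    ∃ c : Fin n, D c = false ∧ keptBefore D c + 1 = p ∧ a ≤ (c : ℕ) ∧ (c : ℕ) + w.length ≤ b ∧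
      (c : ℕ) + w.length ≤ n ∧
      ∀ r (hr : (c : ℕ) + r < n), r < w.length → w[r]? = some (x ⟨c + r, hr⟩) := by
  obtain ⟨h1, h2, h3⟩ := hw
  have hQ1 := hQ.one_le
  have hQ2 := hQ.le_length
  obtain ⟨c, hc, hcp⟩ := exists_source (D := D) (q := p) (by omega) (by omega)
  have hcm := hQ.source_mem c hc (by omega) (by omega)
  have key : ∀ r, r < w.length → ∃ i : Fin n, (i : ℕ) = c + r ∧ D i = false ∧
      keptBefore D i = p - 1 + r ∧ (i : ℕ) < b := by
    intro r hr
    obtain ⟨i, hi, hip⟩ := exists_source (D := D) (q := p + r) (by omega) (by omega)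
    have him := hQ.source_mem i hi (by omega) (by omega)
    have hci : (c : ℕ) ≤ i := by
      by_contra hlt
      have := keptBefore_lt hi (not_le.1 hlt)
      omega
    have := keptBefore_of_delIn_eq_zero h (by omega) hci (by omega) i.isLt.le
    exact ⟨i, by omega, hi, by omega, him.2⟩
  obtain ⟨i, hi1, hi2, hi3, hi4⟩ := key (w.length - 1) (by omega)
  refine ⟨c, hc, hcp, hcm.1, by omega, by have := i.isLt; omega, fun r hr hrw => ?_⟩
  obtain ⟨i, hi1, hi2, hi3, hi4⟩ := key r hrw
  obtain rfl : i = ⟨c + r, hr⟩ := Fin.ext hi1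
  rw [← h3, List.getElem?_take, if_pos hrw, List.getElem?_drop, trace, List.getElem?_map,
    kept_getElem?_eq_some.2 ⟨hi2, hi3⟩]
  rfl

end Clean

theorem ncard_setOf {p : Fin M → Prop} [DecidablePred p] :
    ({m | p m} : Set (Fin M)).ncard = (Finset.univ.filter p).card := by
  rw [← Set.ncard_coe_finset]
  congr 1
  ext m
  simp

/-- If few traces have a deletion near `j` and `x` does not overlap itself there, then the
second stage finds a common word, and this word has a unique source. -/
theorem SecondStage.success {x : Fin n → Bool} {D : Fin M → Deletions n} {h : ℕ} {j : Fin n}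
    {Q : Fin M → ℕ × ℕ} {ℓ : Fin M → ℕ} {t : ℕ} (ht : t = windowLen h 1) (htl : 4000 ≤ t)
    (hM : 0 < M) (hloc : ∀ m, Focused (D m) (Q m) t j)
    (hdirty : 20 * (dirty D (j - 2 * t) (j + 2 * t)).card ≤ M)
    (hself : ¬ SelfOverlaps x ((9 * t + 9) / 10) (j - 2 * t) (j + 2 * t))
    (hj1 : 47 * t / 100 ≤ j) (hj2 : (j : ℕ) + 47 * t / 100 < n)
    (hs : SecondStage h (fun m => trace x (D m)) Q ℓ) :
    ∃ i : Fin n, (0.9 : ℝ) * M ≤ ({m | IsSource (D m) (ℓ m) i} : Set (Fin M)).ncard ∧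
      (j : ℕ) ≤ i + 21 * t / 40 ∧ i ≤ j := by
  classical
  set L := (9 * t + 9) / 10 with hL
  set lo := (j : ℕ) - 2 * t with hlo
  set hi := (j : ℕ) + 2 * t with hhi
  have hclean : ∀ m, m ∉ dirty D lo hi → delIn (D m) lo hi = 0 := by
    intro m hm
    simpa [dirty] using hm
  have hcast : ∀ w : List Bool, ((0.9 : ℝ) * windowLen h 1 ≤ w.length) ↔ L ≤ w.length := by
    intro w
    have h1 : ((0.9 : ℝ) * windowLen h 1 ≤ w.length) ↔ 9 * t ≤ 10 * w.length := by
      rw [← ht, ← Nat.cast_le (α := ℝ)]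
      push_cast
      constructor <;> intro h <;> linarith
    rw [h1]
    omega
  have hcompl : (Finset.univ.filter fun m => m ∉ dirty D lo hi).card + (dirty D lo hi).card = M := by
    have h1 := Finset.card_filter_add_card_filter_not (s := (Finset.univ : Finset (Fin M)))
      (p := fun m => m ∈ dirty D lo hi)
    rw [Finset.card_univ, Fintype.card_fin] at h1
    have h2 : (Finset.univ.filter fun m => m ∈ dirty D lo hi) = dirty D lo hi := by
      ext m
      simp
    rw [h2] at h1
    omega
  rcases hs with ⟨hno, -⟩ | ⟨w, ⟨hw1, hw2⟩, hw3⟩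
  · -- The bits of `x` in a fixed window of length `0.9 t` around `j` are a common word.
    exfalso
    apply hno
    set a := (j : ℕ) - 47 * t / 100 with ha
    have hlen : ((keptIn (fun _ : Fin n => false) a (a + L)).map x).length = L := by
      have h1 : (keptIn (fun _ : Fin n => false) a (a + L)).length = L := by
        rw [← List.toFinset_card_of_nodup
          ((keptIn_pairwise _ _ _).imp fun h => ne_of_lt h)]
        have h2 := card_window (n := n) a (a + L) (by omega)
        rw [Nat.add_sub_cancel_left] at h2
        refine Eq.trans ?_ h2
        congr 1
        ext i
        simp [mem_keptIn]
      rw [List.length_map, h1]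
    refine ⟨(keptIn (fun _ => false) a (a + L)).map x, (hcast _).2 hlen.ge, ?_⟩
    rw [ncard_setOf]
    have hsub : (Finset.univ.filter fun m => m ∉ dirty D lo hi).card ≤
        (Finset.univ.filter fun m => ∃ p, OccursAt ((keptIn (fun _ => false) a (a + L)).map x)
          (trace x (D m)) (Q m) p).card := by
      refine Finset.card_le_card fun m hm => ?_
      simp only [Finset.mem_filter, Finset.mem_univ, true_and] at hm ⊢
      have hm0 := hclean m hm
      have h1 := hloc m
      have h2 := eq_false_of_delIn_eq_zero hm0 (i := ⟨a, by omega⟩) (by simp; omega)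
        (by simp; omega)
      have h3 := h1.mem_of_source _ h2 (by simp; omega) (by simp; omega)
      have h4 := eq_false_of_delIn_eq_zero hm0 (i := ⟨a + L - 1, by omega⟩) (by simp; omega)
        (by simp; omega)
      have h5 := h1.mem_of_source _ h4 (by simp; omega) (by simp; omega)
      have h6 := keptBefore_of_delIn_eq_zero hm0 (a := a) (b := a + L - 1) (by omega) (by omega)
        (by omega) (by omega)
      dsimp only at h3 h5
      refine ⟨keptBefore (D m) a + 1, by omega, ?_, ?_⟩
      · rw [hlen]
        omega
      · rw [hlen, Nat.add_sub_cancel]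
        exact drop_take_trace_of_clean hm0 (by omega) (by omega) (by omega)
    have h2 : 19 * M ≤ 20 * (Finset.univ.filter fun m => ∃ p,
        OccursAt ((keptIn (fun _ => false) a (a + L)).map x)
          (trace x (D m)) (Q m) p).card := by omega
    have h3 : (19 * M : ℝ) ≤ 20 * (Finset.univ.filter fun m => ∃ p,
        OccursAt ((keptIn (fun _ => false) a (a + L)).map x)
          (trace x (D m)) (Q m) p).card := by exact_mod_cast h2
    linarith
  · rw [hcast] at hw1
    set O := Finset.univ.filter fun m => ∃ p, OccursAt w (trace x (D m)) (Q m) p with hO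
    rw [ncard_setOf] at hw2
    have hO2 : 19 * M ≤ 20 * O.card := by
      rw [← Nat.cast_le (α := ℝ)]
      push_cast
      linarith
    set G := O.filter fun m => m ∉ dirty D lo hi with hG
    have hGc : 9 * M ≤ 10 * G.card := by
      have h1 : (O.filter fun m => m ∈ dirty D lo hi).card + G.card = O.card :=
        Finset.card_filter_add_card_filter_not _
      have h2 : (O.filter fun m => m ∈ dirty D lo hi).card ≤ (dirty D lo hi).card :=
        Finset.card_le_card fun m hm => (Finset.mem_filter.1 hm).2
      omega
    have hsrc : ∀ m ∈ G, ∃ c : Fin n, IsSource (D m) (ℓ m) c ∧ (j : ℕ) - 21 * t / 40 ≤ c ∧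
        (c : ℕ) + w.length ≤ (j + 21 * t / 40 + 1) ∧ (c : ℕ) + w.length ≤ n ∧
        ∀ r (hr : (c : ℕ) + r < n), r < w.length → w[r]? = some (x ⟨c + r, hr⟩) := by
      intro m hm
      rw [hG, Finset.mem_filter, hO, Finset.mem_filter] at hm
      have hoc : OccursAt w (trace x (D m)) (Q m) (ℓ m) := by
        rcases hw3 m with h1 | ⟨h1, -⟩
        · exact h1
        · exact absurd hm.1.2 h1
      obtain ⟨c, h1, h2, h3, h4, h5, h6⟩ := exists_source_of_occursAt (hclean m hm.2) (hloc m)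
        (by omega) (by omega) hoc (by omega)
      exact ⟨c, isSource_iff.2 ⟨h1, h2⟩, h3, h4, h5, h6⟩
    have hne : G.Nonempty := Finset.card_pos.1 (by omega)
    obtain ⟨m₀, hm₀⟩ := hne
    obtain ⟨c, hc1, hc2, hc3, hc4, hc5⟩ := hsrc m₀ hm₀
    refine ⟨c, ?_, by omega, Fin.le_def.2 (by omega)⟩
    have hsub : G.card ≤ (Finset.univ.filter fun m => IsSource (D m) (ℓ m) c).card := by
      refine Finset.card_le_card fun m hm => ?_
      simp only [Finset.mem_filter, Finset.mem_univ, true_and]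
      obtain ⟨c', hd1, hd2, hd3, hd4, hd5⟩ := hsrc m hm
      have : c' = c := by
        by_contra hcc
        refine hself ⟨c, c', by omega, by omega, fun h => hcc (Fin.ext h.symm),
          fun r => ⟨c + r, by omega⟩, fun r => ⟨c' + r, by omega⟩, fun r => ⟨rfl, rfl, ?_⟩⟩
        have h1 := hc5 r (by omega) (by omega)
        have h2 := hd5 r (by omega) (by omega)
        exact Option.some_injective _ (h1.symm.trans h2)
      rw [← this]
      exact hd1
    rw [ncard_setOf]
    have h2 : 9 * M ≤ 10 * (Finset.univ.filter fun m => IsSource (D m) (ℓ m) c).card := by omega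
    have h3 : (9 * M : ℝ) ≤ 10 * (Finset.univ.filter fun m => IsSource (D m) (ℓ m) c).card := by
      exact_mod_cast h2
    linarith

/-! ### A deterministic criterion for success -/

/-- The local obstructions to success at the source location `j`: a bad scale below the top one, too
many traces with a deletion near `j`, or an overlap of `x` with itself near `j`. -/
def BadNear (h S : ℕ) (x : Fin n → Bool) (E : Deletions n) (D : Fin M → Deletions n) (j : ℕ) :
    Prop :=
  (∃ s, (1 ≤ s ∧ s < S) ∧
    BadLevel x E D (windowLen h s) j (j - 2 * windowLen h s) (j + 2 * windowLen h s)) ∨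
  M < 20 * (dirty D (j - 2 * windowLen h 1) (j + 2 * windowLen h 1)).card ∨
  SelfOverlaps x ((9 * windowLen h 1 + 9) / 10) (j - 2 * windowLen h 1) (j + 2 * windowLen h 1)

/-- Without obstructions at the source `j` of the reference location, every output of Align
points, in 90% of the traces, to one source at or before `j`, at distance at most `21 t₁ / 40`. -/
theorem IsAlignOutput.success {x : Fin n → Bool} {E : Deletions n} {D : Fin M → Deletions n}
    {h l S : ℕ} {j : Fin n} {ℓ : Fin M → ℕ} (hS : numLevels n h = S) (hS1 : 1 ≤ S)
    (htl : 4000 ≤ windowLen h 1) (hM : 0 < M)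
    (htop : ¬ BadLevel x E D (windowLen h S) j 0 n) (hnear : ¬ BadNear h S x E D j)
    (hj : keptBefore E j + 1 = l) (hl1 : (windowLen h S - 1) / 2 + 1 ≤ l)
    (hl2 : l + (windowLen h S - 1) / 2 ≤ keptBefore E n)
    (hout : IsAlignOutput n h l (trace x E) (fun m => trace x (D m)) ℓ) :
    ∃ i : Fin n, (0.9 : ℝ) * M ≤ ({m | IsSource (D m) (ℓ m) i} : Set (Fin M)).ncard ∧
      (j : ℕ) ≤ i + 21 * windowLen h 1 / 40 ∧ i ≤ j := by
  obtain ⟨r, hr, hcase⟩ := hout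
  rw [hS] at hr
  obtain ⟨s, rfl⟩ := Nat.exists_eq_add_of_le' hS1
  simp only [BadLevel, not_or, not_exists, not_not] at htop
  simp only [BadNear, BadLevel, not_or, not_exists, not_and, not_not, not_lt] at hnear
  obtain ⟨hT1, hT2, hT3⟩ := htop
  obtain ⟨hN1, hN2, hN3⟩ := hnear
  have hm1 := windowLen_mono h hS1
  have hm2 := windowLen_mono h (show s ≤ s + 1 by omega)
  have hjn := j.isLt
  have hfoc : ∀ m, ∃ Q', r m = some Q' ∧ Focused (D m) Q' (windowLen h 1) j := by
    intro m
    have hr0 := hr m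
    rw [length_trace] at hr0
    obtain ⟨Q', hQ', hr'⟩ := Narrows.exists_focused (by omega) hT1 (hT2 m) hT3 (by omega) (by omega)
      hj hl1 hl2 (locates_univ (D m) 0 n) (by omega) (by omega) hr0
    refine Narrows.focused_of_local htl (fun s' h1 h2 => ?_) hj (by omega) (by omega) hQ' hr'
    have h3 := hN1 s' ⟨h1, by omega⟩
    exact ⟨h3.1, h3.2.1 m, h3.2.2⟩
  rcases hcase with ⟨⟨m, hm⟩, -⟩ | ⟨Q, hQ, hs⟩
  · obtain ⟨Q', h1, -⟩ := hfoc m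
    rw [hm] at h1
    cases h1
  · have hloc : ∀ m, Focused (D m) (Q m) (windowLen h 1) j := by
      intro m
      obtain ⟨Q', h1, h2⟩ := hfoc m
      rw [hQ m] at h1
      cases h1
      exact h2
    have hk0 := keptBefore_le_add E (Nat.zero_le (j : ℕ))
    have hk1 := keptBefore_le_add E hjn.le
    have hk2 : keptBefore E 0 = 0 := by simp [keptBefore]
    exact hs.success rfl htl hM hloc hN2 hN3 (by omega) (by omega)

/-! ### Union bounds -/

theorem measureReal_le_card_mul {Ω ι : Type*} [MeasurableSpace Ω] (μ : Measure Ω)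
    [IsFiniteMeasure μ] (s : Finset ι) {A : Set Ω} {B : ι → Set Ω} {q : ℝ}
    (h : A ⊆ ⋃ i ∈ s, B i) (hB : ∀ i ∈ s, μ.real (B i) ≤ q) : μ.real A ≤ s.card * q :=
  calc μ.real A ≤ _ := measureReal_mono h (measure_ne_top _ _)
    _ ≤ _ := measureReal_biUnion_finset_le _ _
    _ ≤ ∑ _i ∈ s, q := Finset.sum_le_sum hB
    _ = _ := by rw [Finset.sum_const, nsmul_eq_mul]

/-- If any `r` of the events occur together with probability at most `q`, then at least `r` of
them occur with probability at most `(s.card.choose r) * q`. -/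
theorem measureReal_le_card_filter {Ω ι : Type*} [MeasurableSpace Ω] (μ : Measure Ω)
    [IsFiniteMeasure μ] (s : Finset ι) (A : ι → Ω → Prop) [∀ ω, DecidablePred fun i => A i ω]
    (r : ℕ) (q : ℝ)
    (h : ∀ T ⊆ s, T.card = r → μ.real {ω | ∀ i ∈ T, A i ω} ≤ q) :
    μ.real {ω | r ≤ (s.filter fun i => A i ω).card} ≤ s.card.choose r * q := by
  have hsub : {ω | r ≤ (s.filter fun i => A i ω).card} ⊆
      ⋃ T ∈ s.powersetCard r, {ω | ∀ i ∈ T, A i ω} := by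
    intro ω hω
    obtain ⟨T, hT, hTr⟩ := Finset.exists_subset_card_eq (Set.mem_ofPred.1 hω)
    simp only [Set.mem_iUnion, Finset.mem_powersetCard]
    exact ⟨T, ⟨hT.trans (Finset.filter_subset _ _), hTr⟩, fun i hi => (Finset.mem_filter.1 (hT hi)).2⟩
  rw [← Finset.card_powersetCard]
  refine measureReal_le_card_mul μ _ hsub fun T hT => ?_
  rw [Finset.mem_powersetCard] at hT
  exact h T hT.1 hT.2

theorem choose_le_pow (N r : ℕ) (hr : 0 < r) : (N.choose r : ℝ) ≤ (3 * N / r) ^ r := by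
  have h1 := Nat.choose_le_pow_div (α := ℝ) r N
  have h2 := Real.pow_div_factorial_le_exp (r : ℝ) (Nat.cast_nonneg r) r
  have h3 : Real.exp r ≤ 3 ^ r := by
    rw [← mul_one (r : ℝ), Real.exp_nat_mul]
    gcongr
    exact Real.exp_one_lt_three.le
  have hr' : (0 : ℝ) < r := by exact_mod_cast hr
  have hf : (0 : ℝ) < r.factorial := by exact_mod_cast r.factorial_pos
  refine h1.trans ?_
  rw [div_pow, mul_pow, div_le_div_iff₀ hf (by positivity)]
  rw [div_le_iff₀ hf] at h2
  have h4 : (r : ℝ) ^ r ≤ 3 ^ r * r.factorial := h2.trans (by gcongr)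
  calc (N : ℝ) ^ r * r ^ r ≤ N ^ r * (3 ^ r * r.factorial) := by gcongr
    _ = _ := by ring

/-- A bound for binomial coefficients with `a` a small fraction of `N`. -/
theorem choose_le_two_pow (N a b : ℕ) (hb : N ≤ 16 * b) :
    (N.choose a : ℝ) ≤ 2 ^ (5 * a + b) := by
  rcases lt_or_ge N a with h | h
  · rw [Nat.choose_eq_zero_of_lt h]
    simp
  -- One term of the binomial expansion of `(1 / 32 + 1) ^ N`.
  have h1 : (1 / 32 : ℝ) ^ a * N.choose a ≤ (1 / 32 + 1) ^ N := by
    rw [add_pow]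
    have := Finset.single_le_sum (f := fun m => (1 / 32 : ℝ) ^ m * 1 ^ (N - m) * (N.choose m : ℝ))
      (s := Finset.range (N + 1)) (fun i _ => by positivity)
      (Finset.mem_range.2 (Nat.lt_succ_of_le h))
    simpa using this
  have h2 : (1 / 32 + 1 : ℝ) ^ N ≤ 2 ^ b := by
    calc (1 / 32 + 1 : ℝ) ^ N ≤ (1 / 32 + 1) ^ (16 * b) := by
          gcongr
          norm_num
      _ = ((1 / 32 + 1) ^ 16) ^ b := by rw [pow_mul]
      _ ≤ 2 ^ b := by
          gcongr
          norm_num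
  have h3 : (2 : ℝ) ^ (5 * a) * (1 / 32) ^ a = 1 := by
    rw [pow_mul, ← mul_pow]
    norm_num
  calc (N.choose a : ℝ) = 2 ^ (5 * a) * ((1 / 32) ^ a * N.choose a) := by
        rw [← mul_assoc, h3, one_mul]
    _ ≤ 2 ^ (5 * a) * 2 ^ b := by
        gcongr
        exact h1.trans h2
    _ = _ := by rw [pow_add]

/-! ### Coincidences in a random string -/

/-- The source locations in `[a, b)`. -/
def window (n a b : ℕ) : Finset (Fin n) :=
  Finset.univ.filter fun i : Fin n => a ≤ (i : ℕ) ∧ (i : ℕ) < b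

theorem mem_window {a b : ℕ} {i : Fin n} : i ∈ window n a b ↔ a ≤ (i : ℕ) ∧ (i : ℕ) < b := by
  simp [window]

theorem card_coincidences (k : ℕ) (f g : Fin k → Fin n) (hf : StrictMono f) (hg : StrictMono g)
    (hfg : ∀ r, f r ≠ g r) :
    2 ^ k * (Finset.univ.filter fun x : Fin n → Bool => ∀ r, x (f r) = x (g r)).card ≤ 2 ^ n := by
  induction k with
  | zero =>
    refine le_trans ?_ (le_of_eq (show Fintype.card (Fin n → Bool) = 2 ^ n by simp))
    rw [pow_zero, one_mul]
    exact Finset.card_le_univ _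
  | succ k ih =>
    have ih' := ih (fun r => f r.castSucc) (fun r => g r.castSucc)
      (hf.comp Fin.strictMono_castSucc) (hg.comp Fin.strictMono_castSucc) fun r => hfg _
    refine le_trans ?_ ih'
    rw [pow_succ, mul_assoc]
    refine Nat.mul_le_mul_left _ ?_
    -- The largest location `v` occurs only in the last pair, so flipping `x v` destroys
    -- the last coincidence and keeps the others.
    set v := max (f (Fin.last k)) (g (Fin.last k)) with hv
    have hfv : ∀ r : Fin k, f r.castSucc ≠ v := fun r =>
      ((hf (Fin.castSucc_lt_last r)).trans_le (le_max_left _ _)).ne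
    have hgv : ∀ r : Fin k, g r.castSucc ≠ v := fun r =>
      ((hg (Fin.castSucc_lt_last r)).trans_le (le_max_right _ _)).ne
    set A := Finset.univ.filter fun x : Fin n → Bool => ∀ r, x (f r) = x (g r) with hA
    set B := Finset.univ.filter fun x : Fin n → Bool =>
      ∀ r : Fin k, x (f r.castSucc) = x (g r.castSucc) with hB
    let flip : (Fin n → Bool) → (Fin n → Bool) := fun x => Function.update x v (!(x v))
    have hflip : Function.Injective flip := by
      intro x y hxy
      funext i
      have h1 := congrFun hxy i
      by_cases hi : i = v
      · subst hi
        simpa [flip] using h1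
      · simpa [flip, hi] using h1
    have hdisj : Disjoint A (A.image flip) := by
      rw [Finset.disjoint_left]
      intro y hy hy'
      obtain ⟨x, hx, rfl⟩ := Finset.mem_image.1 hy'
      have h1 := (Finset.mem_filter.1 hx).2 (Fin.last k)
      have h2 := (Finset.mem_filter.1 hy).2 (Fin.last k)
      have h3 := hfg (Fin.last k)
      rcases max_choice (f (Fin.last k)) (g (Fin.last k)) with h4 | h4
      · rw [← hv] at h4
        simp only [flip, h4, Function.update_self, Function.update_of_ne h3.symm] at h2
        rw [← h1] at h2
        cases hx' : x (f (Fin.last k)) <;> simp [hx'] at h2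
      · rw [← hv] at h4
        simp only [flip, h4, Function.update_self, Function.update_of_ne h3] at h2
        rw [h1] at h2
        cases hx' : x (g (Fin.last k)) <;> simp [hx'] at h2
    have hsub : A ∪ A.image flip ⊆ B := by
      intro y hy
      rw [hB, Finset.mem_filter]
      refine ⟨Finset.mem_univ _, fun r => ?_⟩
      rcases Finset.mem_union.1 hy with hy | hy
      · exact (Finset.mem_filter.1 hy).2 r.castSucc
      · obtain ⟨x, hx, rfl⟩ := Finset.mem_image.1 hy
        simp only [flip, Function.update_of_ne (hfv r), Function.update_of_ne (hgv r)]
        exact (Finset.mem_filter.1 hx).2 r.castSucc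
    have h1 := Finset.card_le_card hsub
    rw [Finset.card_union_of_disjoint hdisj, Finset.card_image_of_injective _ hflip] at h1
    omega

theorem uniformOn_real (p : (Fin n → Bool) → Prop) [DecidablePred p] :
    (uniformOn (Set.univ : Set (Fin n → Bool))).real {x | p x} =
      (Finset.univ.filter p).card / 2 ^ n := by
  have h1 : {x | p x} = ((Finset.univ.filter p : Finset (Fin n → Bool)) : Set (Fin n → Bool)) := by
    ext x
    simp
  rw [Measure.real, uniformOn_univ, h1, Measure.count_apply_finset]
  simp

/-- Coincidences at `k` pairs of distinct locations, increasing in both components, have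
probability at most `2 ^ (-k)`: as a graph, the pairs form a forest. -/
theorem uniformOn_coincidences (k : ℕ) (f g : Fin k → Fin n) (hf : StrictMono f)
    (hg : StrictMono g) (hfg : ∀ r, f r ≠ g r) :
    (uniformOn (Set.univ : Set (Fin n → Bool))).real {x | ∀ r, x (f r) = x (g r)} ≤
      (1 / 2) ^ k := by
  rw [uniformOn_real, div_le_iff₀ (by positivity), one_div, inv_pow, ← div_eq_inv_mul,
    le_div_iff₀ (by positivity)]
  have := card_coincidences k f g hf hg hfg
  rw [mul_comm]
  exact_mod_cast this

/-- Increasing families are determined by their ranges. -/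
theorem card_strictMono_le (k : ℕ) (W : Finset (Fin n)) [DecidablePred fun f : Fin k → Fin n =>
    StrictMono f ∧ ∀ r, f r ∈ W] :
    (Finset.univ.filter fun f : Fin k → Fin n => StrictMono f ∧ ∀ r, f r ∈ W).card ≤
      W.card.choose k := by
  rw [← Finset.card_powersetCard]
  refine Finset.card_le_card_of_injOn (fun f => Finset.univ.image f) ?_ ?_
  · intro f hf
    have hf' := (Finset.mem_filter.1 hf).2
    refine Finset.mem_coe.2 (Finset.mem_powersetCard.2 ⟨fun i hi => ?_, ?_⟩)
    · obtain ⟨r, -, rfl⟩ := Finset.mem_image.1 hi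
      exact hf'.2 r
    · rw [Finset.card_image_of_injective _ hf'.1.injective, Finset.card_univ, Fintype.card_fin]
  · intro f hf g hg hfg
    have hf' := (Finset.mem_filter.1 hf).2
    have hg' := (Finset.mem_filter.1 hg).2
    rw [← StrictMono.range_inj hf'.1 hg'.1]
    have h1 := congrArg (fun s : Finset (Fin n) => (s : Set (Fin n))) hfg
    simpa using h1

theorem uniformOn_repeats_le (t j lo hi : ℕ) :
    (uniformOn (Set.univ : Set (Fin n → Bool))).real {x | Repeats x t j lo hi} ≤
      (hi - lo : ℕ) * (((t + t / 40).choose (t - t / 50) : ℝ) ^ 2 * (1 / 2) ^ (t - t / 50)) := by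
  classical
  set μ := uniformOn (Set.univ : Set (Fin n → Bool))
  set k := t - t / 50 with hk
  set N := t + t / 40 with hN
  let F : ℕ → Finset (Fin k → Fin n) := fun c =>
    Finset.univ.filter fun f => StrictMono f ∧ ∀ r, f r ∈ window n c (c + N)
  have hF : ∀ c, ((F c).card : ℝ) ≤ N.choose k := by
    intro c
    have h1 := card_strictMono_le k (window n c (c + N))
    have h2 : (window n c (c + N)).card ≤ N := by
      have := card_window_le (n := n) c (c + N)
      rwa [Nat.add_sub_cancel_left] at this
    exact_mod_cast h1.trans (Nat.choose_le_choose k h2)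
  have hsub : {x | Repeats x t j lo hi} ⊆ ⋃ c ∈ Finset.Ico lo hi,
      ⋃ p ∈ ((F (j - (t / 2 + t / 400))) ×ˢ (F c)).filter fun p => ∀ r, p.1 r ≠ p.2 r,
        {x | ∀ r, x (p.1 r) = x (p.2 r)} := by
    rintro x ⟨c, hc1, hc2, f, g, hf, hg, h⟩
    simp only [Set.mem_iUnion, Finset.mem_Ico, Finset.mem_filter, Finset.mem_product]
    refine ⟨c, ⟨hc1, hc2⟩, (f, g), ⟨⟨?_, ?_⟩, fun r => (h r).2.2.1⟩, fun r => (h r).2.2.2⟩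
    · exact Finset.mem_filter.2 ⟨Finset.mem_univ _, hf, fun r => mem_window.2 (h r).1⟩
    · exact Finset.mem_filter.2 ⟨Finset.mem_univ _, hg, fun r => mem_window.2 (h r).2.1⟩
  rw [← Nat.card_Ico]
  refine measureReal_le_card_mul μ _ hsub fun c _ => ?_
  refine (measureReal_le_card_mul μ _ (q := (1 / 2) ^ k) subset_rfl fun p hp => ?_).trans
    (mul_le_mul_of_nonneg_right ?_ (by positivity))
  · rw [Finset.mem_filter, Finset.mem_product] at hp
    exact uniformOn_coincidences k p.1 p.2 (Finset.mem_filter.1 hp.1.1).2.1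
      (Finset.mem_filter.1 hp.1.2).2.1 hp.2
  · calc _ ≤ ((((F (j - (t / 2 + t / 400))) ×ˢ (F c)).card : ℕ) : ℝ) := by
          exact_mod_cast Finset.card_filter_le _ _
      _ = ((F (j - (t / 2 + t / 400))).card : ℝ) * (F c).card := by
          rw [Finset.card_product, Nat.cast_mul]
      _ ≤ (N.choose k : ℝ) * N.choose k :=
          mul_le_mul (hF _) (hF _) (Nat.cast_nonneg _) (Nat.cast_nonneg _)
      _ = _ := (pow_two _).symm

theorem uniformOn_selfOverlaps_le (L lo hi : ℕ) :
    (uniformOn (Set.univ : Set (Fin n → Bool))).real {x | SelfOverlaps x L lo hi} ≤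
      ((hi - lo : ℕ) : ℝ) ^ 2 * (1 / 2) ^ L := by
  classical
  set μ := uniformOn (Set.univ : Set (Fin n → Bool))
  have hsub : {x | SelfOverlaps x L lo hi} ⊆ ⋃ p ∈ Finset.Ico lo hi ×ˢ Finset.Ico lo hi,
      {x | p.1 ≠ p.2 ∧ ∃ f g : Fin L → Fin n,
        ∀ r, (f r : ℕ) = p.1 + r ∧ (g r : ℕ) = p.2 + r ∧ x (f r) = x (g r)} := by
    rintro x ⟨c, c', hc, hc', hne, h⟩
    simp only [Set.mem_iUnion, Finset.mem_product, Finset.mem_Ico]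
    exact ⟨(c, c'), ⟨hc, hc'⟩, hne, h⟩
  rw [pow_two, ← Nat.card_Ico, ← Nat.cast_mul, ← Finset.card_product]
  refine measureReal_le_card_mul μ _ hsub fun p _ => ?_
  by_cases hp : p.1 ≠ p.2 ∧ ∃ f g : Fin L → Fin n, ∀ r, (f r : ℕ) = p.1 + r ∧ (g r : ℕ) = p.2 + r
  · obtain ⟨hne, f, g, hfg⟩ := hp
    refine le_trans (measureReal_mono ?_) (uniformOn_coincidences L f g ?_ ?_ ?_)
    · rintro x ⟨-, f', g', h⟩ r
      obtain ⟨h1, h2, h3⟩ := h r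
      have e1 : f r = f' r := Fin.ext ((hfg r).1.trans h1.symm)
      have e2 : g r = g' r := Fin.ext ((hfg r).2.trans h2.symm)
      rw [e1, e2, h3]
    · intro a b hab
      rw [Fin.lt_def, (hfg a).1, (hfg b).1]
      have := Fin.lt_def.1 hab
      omega
    · intro a b hab
      rw [Fin.lt_def, (hfg a).2, (hfg b).2]
      have := Fin.lt_def.1 hab
      omega
    · intro r h
      have h1 := congrArg Fin.val h
      rw [(hfg r).1, (hfg r).2] at h1
      omega
  · have hempty : {x : Fin n → Bool | p.1 ≠ p.2 ∧ ∃ f g : Fin L → Fin n,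
        ∀ r, (f r : ℕ) = p.1 + r ∧ (g r : ℕ) = p.2 + r ∧ x (f r) = x (g r)} = ∅ := by
      ext x
      simp only [Set.mem_ofPred_eq, Set.mem_empty_iff_false, iff_false]
      rintro ⟨hne, f, g, h⟩
      exact hp ⟨hne, f, g, fun r => ⟨(h r).1, (h r).2.1⟩⟩
    rw [hempty, measureReal_empty]
    positivity

variable {δ : ℝ}

/-! ### Deletions -/

theorem isProbabilityMeasure_flagLaw (h0 : 0 ≤ δ) (h1 : δ ≤ 1) :
    IsProbabilityMeasure (flagLaw δ) := by
  constructor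
  simp only [flagLaw, Measure.coe_add, Measure.coe_smul, Pi.add_apply, Pi.smul_apply, measure_univ,
    smul_eq_mul, mul_one]
  rw [← ENNReal.ofReal_add h0 (by linarith)]
  simp

theorem flagLaw_true (h0 : 0 ≤ δ) : (flagLaw δ).real {true} = δ := by
  simp [Measure.real, flagLaw, h0]

theorem isProbabilityMeasure_deletionLaw (n : ℕ) (h0 : 0 ≤ δ) (h1 : δ ≤ 1) :
    IsProbabilityMeasure (deletionLaw n δ) := by
  have := isProbabilityMeasure_flagLaw h0 h1
  unfold deletionLaw
  infer_instance

theorem isProbabilityMeasure_outcomeLaw (n M : ℕ) (h0 : 0 ≤ δ) (h1 : δ ≤ 1) :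
    IsProbabilityMeasure (outcomeLaw n M δ) := by
  have := isProbabilityMeasure_flagLaw h0 h1
  have := isProbabilityMeasure_deletionLaw n h0 h1
  unfold outcomeLaw
  infer_instance

theorem deletionLaw_forall (h0 : 0 ≤ δ) (h1 : δ ≤ 1) (T : Finset (Fin n)) :
    (deletionLaw n δ).real {D | ∀ i ∈ T, D i = true} = δ ^ T.card := by
  classical
  have := isProbabilityMeasure_flagLaw h0 h1
  have hset : {D : Deletions n | ∀ i ∈ T, D i = true} =
      Set.univ.pi fun i => if i ∈ T then {true} else Set.univ := by
    ext D
    simp only [Set.mem_ofPred_eq, Set.mem_pi, Set.mem_univ, true_implies]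
    refine forall_congr' fun i => ?_
    by_cases hi : i ∈ T <;> simp [hi]
  rw [hset, Measure.real, deletionLaw, Measure.pi_pi, ENNReal.toReal_prod]
  have h2 : ∀ i, (flagLaw δ (if i ∈ T then {true} else Set.univ)).toReal =
      if i ∈ T then δ else 1 := by
    intro i
    split_ifs
    · exact flagLaw_true h0
    · rw [measure_univ, ENNReal.toReal_one]
  simp_rw [h2]
  rw [Finset.prod_ite_mem, Finset.univ_inter, Finset.prod_const]

theorem delIn_eq_card_window (D : Deletions n) (a b : ℕ) :
    delIn D a b = ((window n a b).filter fun i => D i = true).card := by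
  rw [delIn, window, Finset.filter_filter]
  simp only [and_assoc]

theorem card_window_add_le (n a L : ℕ) : (window n a (a + L)).card ≤ L := by
  have := card_window_le (n := n) a (a + L)
  rwa [Nat.add_sub_cancel_left] at this

theorem deletionLaw_delIn_ge (h0 : 0 ≤ δ) (h1 : δ ≤ 1) (a L r : ℕ) :
    (deletionLaw n δ).real {D | r ≤ delIn D a (a + L)} ≤ L.choose r * δ ^ r := by
  have := isProbabilityMeasure_deletionLaw n h0 h1
  simp_rw [delIn_eq_card_window]
  refine (measureReal_le_card_filter (deletionLaw n δ) (window n a (a + L))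
    (fun i D => D i = true) r (δ ^ r) fun T _ hTr => ?_).trans ?_
  · rw [deletionLaw_forall h0 h1, hTr]
  · gcongr
    exact card_window_add_le n a L

theorem deletionLaw_not_sparse_le (h0 : 0 ≤ δ) (h1 : δ ≤ 1) (t lo hi : ℕ) :
    (deletionLaw n δ).real {D | ¬ Sparse D t lo hi} ≤
      (hi - lo : ℕ) * ((4 * t).choose (t / 400 + 1) * δ ^ (t / 400 + 1)) := by
  have := isProbabilityMeasure_deletionLaw n h0 h1
  rw [← Nat.card_Ico]
  refine measureReal_le_card_mul (deletionLaw n δ) _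
    (B := fun c => {D | t / 400 + 1 ≤ delIn D c (c + 4 * t)}) ?_
    fun c _ => deletionLaw_delIn_ge h0 h1 c (4 * t) (t / 400 + 1)
  intro D hD
  simp only [Set.mem_ofPred_eq, Sparse, not_forall, not_le] at hD
  obtain ⟨c, hc1, hc2, hc3⟩ := hD
  simp only [Set.mem_iUnion, Finset.mem_Ico, Set.mem_ofPred_eq]
  exact ⟨c, ⟨hc1, hc2⟩, by omega⟩

theorem pi_deletionLaw_dirty_ge (h0 : 0 ≤ δ) (h1 : δ ≤ 1) (a L r : ℕ) :
    (Measure.pi fun _ : Fin M => deletionLaw n δ).real {D | r ≤ (dirty D a (a + L)).card} ≤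
      M.choose r * (L * δ) ^ r := by
  classical
  have := isProbabilityMeasure_deletionLaw n h0 h1
  unfold dirty
  have h2 := measureReal_le_card_filter (Measure.pi fun _ : Fin M => deletionLaw n δ) Finset.univ
    (fun m D => 0 < delIn (D m) a (a + L)) r ((L * δ) ^ r) fun T _ hTr => ?_
  · rwa [Finset.card_univ, Fintype.card_fin] at h2
  have hset : {D : Fin M → Deletions n | ∀ m ∈ T, 0 < delIn (D m) a (a + L)} =
      Set.univ.pi fun m => if m ∈ T then {D | 0 < delIn D a (a + L)} else Set.univ := by
    ext D
    simp only [Set.mem_ofPred_eq, Set.mem_pi, Set.mem_univ, true_implies]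
    refine forall_congr' fun m => ?_
    by_cases hm : m ∈ T <;> simp [hm]
  rw [hset, Measure.real, Measure.pi_pi, ENNReal.toReal_prod]
  have h3 : ∀ m, (deletionLaw n δ (if m ∈ T then {D | 0 < delIn D a (a + L)} else Set.univ)).toReal
      ≤ if m ∈ T then L * δ else 1 := by
    intro m
    split_ifs
    · have h4 := deletionLaw_delIn_ge (n := n) h0 h1 a L 1
      rw [Nat.choose_one_right, pow_one] at h4
      exact h4
    · simp
  refine (Finset.prod_le_prod (fun _ _ => ENNReal.toReal_nonneg) fun m _ => h3 m).trans ?_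
  rw [Finset.prod_ite_mem, Finset.univ_inter, Finset.prod_const, hTr]

/-! ### The law of the outcome -/

theorem outcomeLaw_fst (h0 : 0 ≤ δ) (h1 : δ ≤ 1) (A : Set (Fin n → Bool)) :
    (outcomeLaw n M δ).real {ω | ω.1 ∈ A} = (uniformOn (Set.univ : Set (Fin n → Bool))).real A := by
  have := isProbabilityMeasure_deletionLaw n h0 h1
  have h2 : MeasurePreserving Prod.fst (outcomeLaw n M δ) (uniformOn Set.univ) :=
    measurePreserving_fst
  exact h2.measureReal_preimage (MeasurableSet.of_discrete.nullMeasurableSet)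

theorem outcomeLaw_star (h0 : 0 ≤ δ) (h1 : δ ≤ 1) (A : Set (Deletions n)) :
    (outcomeLaw n M δ).real {ω | ω.2.1 ∈ A} = (deletionLaw n δ).real A := by
  have := isProbabilityMeasure_deletionLaw n h0 h1
  have h2 : MeasurePreserving (fun ω : Outcome n M => ω.2.1) (outcomeLaw n M δ)
      (deletionLaw n δ) := measurePreserving_fst.comp measurePreserving_snd
  exact h2.measureReal_preimage (MeasurableSet.of_discrete.nullMeasurableSet)

theorem outcomeLaw_traces (h0 : 0 ≤ δ) (h1 : δ ≤ 1) (A : Set (Fin M → Deletions n)) :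
    (outcomeLaw n M δ).real {ω | ω.2.2 ∈ A} =
      (Measure.pi fun _ : Fin M => deletionLaw n δ).real A := by
  have := isProbabilityMeasure_deletionLaw n h0 h1
  have h2 : MeasurePreserving (fun ω : Outcome n M => ω.2.2) (outcomeLaw n M δ)
      (Measure.pi fun _ : Fin M => deletionLaw n δ) :=
    measurePreserving_snd.comp measurePreserving_snd
  exact h2.measureReal_preimage (MeasurableSet.of_discrete.nullMeasurableSet)

theorem outcomeLaw_trace (h0 : 0 ≤ δ) (h1 : δ ≤ 1) (m : Fin M) (A : Set (Deletions n)) :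
    (outcomeLaw n M δ).real {ω | ω.2.2 m ∈ A} = (deletionLaw n δ).real A := by
  have := isProbabilityMeasure_deletionLaw n h0 h1
  refine (outcomeLaw_traces h0 h1 {D | D m ∈ A}).trans ?_
  exact (measurePreserving_eval (fun _ : Fin M => deletionLaw n δ) m).measureReal_preimage
    (MeasurableSet.of_discrete.nullMeasurableSet)

theorem outcomeLaw_badLevel_le (h0 : 0 ≤ δ) (h1 : δ ≤ 1) (t j lo hi : ℕ) :
    (outcomeLaw n M δ).real {ω | BadLevel ω.1 ω.2.1 ω.2.2 t j lo hi} ≤ (hi - lo : ℕ) *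
      ((M + 1) * ((4 * t).choose (t / 400 + 1) * δ ^ (t / 400 + 1)) +
        ((t + t / 40).choose (t - t / 50) : ℝ) ^ 2 * (1 / 2) ^ (t - t / 50)) := by
  have := isProbabilityMeasure_outcomeLaw n M h0 h1
  have hsub : {ω : Outcome n M | BadLevel ω.1 ω.2.1 ω.2.2 t j lo hi} ⊆
      {ω | ω.2.1 ∈ {D | ¬ Sparse D t lo hi}} ∪
      ((⋃ m ∈ (Finset.univ : Finset (Fin M)), {ω | ω.2.2 m ∈ {D | ¬ Sparse D t lo hi}}) ∪
        {ω | ω.1 ∈ {x | Repeats x t j lo hi}}) := by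
    rintro ω (h | ⟨m, h⟩ | h)
    · exact Or.inl h
    · refine Or.inr (Or.inl ?_)
      simp only [Set.mem_iUnion]
      exact ⟨m, Finset.mem_univ m, h⟩
    · exact Or.inr (Or.inr h)
  have h2 := deletionLaw_not_sparse_le (n := n) h0 h1 t lo hi
  have h3 := uniformOn_repeats_le (n := n) t j lo hi
  have h4 := measureReal_le_card_mul (outcomeLaw n M δ) (Finset.univ : Finset (Fin M))
    (B := fun m => {ω | ω.2.2 m ∈ {D | ¬ Sparse D t lo hi}}) subset_rfl
    fun m _ => (outcomeLaw_trace h0 h1 m _).trans_le h2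
  rw [Finset.card_univ, Fintype.card_fin] at h4
  have h5 := (outcomeLaw_star (M := M) h0 h1 {D : Deletions n | ¬ Sparse D t lo hi}).trans_le h2
  have h6 := (outcomeLaw_fst (M := M) h0 h1 {x : Fin n → Bool | Repeats x t j lo hi}).trans_le h3
  have h7 := (measureReal_mono hsub (measure_ne_top (outcomeLaw n M δ) _)).trans
    ((measureReal_union_le _ _).trans (add_le_add h5 ((measureReal_union_le _ _).trans
      (add_le_add h4 h6))))
  refine h7.trans (le_of_eq ?_)
  ring

/-! ### Independence of distant windows -/

/-- Under a product measure, events that depend on pairwise disjoint sets of coordinates are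
independent. -/
theorem pi_biInter_le {ι α : Type*} [Fintype ι] [DecidableEq ι] [Fintype α] [MeasurableSpace α]
    [MeasurableSingletonClass α] (ν : Measure α) [IsProbabilityMeasure ν]
    {κ : Type*} [DecidableEq κ] (W : κ → Finset ι) (C : κ → Set (ι → α)) (p : ℝ) (T : Finset κ)
    (hW : ∀ j ∈ T, ∀ k ∈ T, j ≠ k → Disjoint (W j) (W k))
    (hC : ∀ j ∈ T, ∀ a b : ι → α, (∀ i ∈ W j, a i = b i) → a ∈ C j → b ∈ C j)
    (hp : ∀ j ∈ T, (Measure.pi fun _ : ι => ν).real (C j) ≤ p) :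
    (Measure.pi fun _ : ι => ν).real {a | ∀ j ∈ T, a ∈ C j} ≤ p ^ T.card := by
  set μ := Measure.pi fun _ : ι => ν with hμ
  induction T using Finset.induction_on with
  | empty => simp
  | insert k T hk ih =>
    have ih' := ih (fun j hj l hl => hW j (Finset.mem_insert_of_mem hj) l
      (Finset.mem_insert_of_mem hl)) (fun j hj => hC j (Finset.mem_insert_of_mem hj))
      (fun j hj => hp j (Finset.mem_insert_of_mem hj))
    have hind : iIndepFun (fun (i : ι) (a : ι → α) => a i) μ :=
      iIndepFun_pi (X := fun _ a => a) fun _ => aemeasurable_id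
    have hdisj : Disjoint (W k) (T.biUnion W) := by
      rw [Finset.disjoint_biUnion_right]
      intro j hj
      exact hW k (Finset.mem_insert_self _ _) j (Finset.mem_insert_of_mem hj)
        fun h => hk (h ▸ hj)
    have hpair := hind.indepFun_finset (W k) (T.biUnion W) hdisj fun i => measurable_pi_apply i
    have h1 : C k = (fun (a : ι → α) (i : W k) => a i) ⁻¹'
        ((fun (a : ι → α) (i : W k) => a i) '' C k) := by
      refine Set.Subset.antisymm (Set.subset_preimage_image _ _) ?_
      rintro b ⟨a, ha, hab⟩
      exact hC k (Finset.mem_insert_self _ _) a b (fun i hi => congrFun hab ⟨i, hi⟩) ha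
    have h2 : {a | ∀ j ∈ T, a ∈ C j} = (fun (a : ι → α) (i : T.biUnion W) => a i) ⁻¹'
        ((fun (a : ι → α) (i : T.biUnion W) => a i) '' {a | ∀ j ∈ T, a ∈ C j}) := by
      refine Set.Subset.antisymm (Set.subset_preimage_image _ _) ?_
      rintro b ⟨a, ha, hab⟩ j hj
      exact hC j (Finset.mem_insert_of_mem hj) a b (fun i hi => congrFun hab
        ⟨i, Finset.mem_biUnion.2 ⟨j, hj, hi⟩⟩) (ha j hj)
    have h3 : {a | ∀ j ∈ insert k T, a ∈ C j} = C k ∩ {a | ∀ j ∈ T, a ∈ C j} := by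
      ext a
      simp
    have h4 := hpair.measure_inter_preimage_eq_mul _ _
      (MeasurableSet.of_discrete (s := (fun (a : ι → α) (i : W k) => a i) '' C k))
      (MeasurableSet.of_discrete
        (s := (fun (a : ι → α) (i : T.biUnion W) => a i) '' {a | ∀ j ∈ T, a ∈ C j}))
    rw [← h1, ← h2] at h4
    rw [h3, Measure.real, h4, ENNReal.toReal_mul, Finset.card_insert_of_notMem hk, pow_succ']
    exact mul_le_mul (hp k (Finset.mem_insert_self _ _)) ih' ENNReal.toReal_nonneg
      (measureReal_nonneg.trans (hp k (Finset.mem_insert_self _ _)))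

/-- The bit and the deletion flags at each location. -/
def columns (ω : Outcome n M) : Fin n → Bool × Bool × (Fin M → Bool) :=
  fun i => (ω.1 i, ω.2.1 i, fun m => ω.2.2 m i)

/-- The law of the bit and the deletion flags at one location. -/
noncomputable def columnLaw (M : ℕ) (δ : ℝ) : Measure (Bool × Bool × (Fin M → Bool)) :=
  (uniformOn (Set.univ : Set Bool)).prod
    ((flagLaw δ).prod (Measure.pi fun _ : Fin M => flagLaw δ))

theorem columns_injective : Function.Injective (columns : Outcome n M → _) := by
  rintro ⟨x, E, D⟩ ⟨x', E', D'⟩ h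
  have h1 : ∀ i, columns (x, E, D) i = columns (x', E', D') i := congrFun h
  simp only [columns, Prod.mk.injEq] at h1
  refine Prod.ext (funext fun i => (h1 i).1) (Prod.ext (funext fun i => (h1 i).2.1) ?_)
  funext m i
  exact congrFun (h1 i).2.2 m

/-- The columns of the outcome are independent. -/
theorem map_columns (h0 : 0 ≤ δ) (h1 : δ ≤ 1) :
    (outcomeLaw n M δ).map columns = Measure.pi fun _ : Fin n => columnLaw M δ := by
  have := isProbabilityMeasure_flagLaw h0 h1
  have := isProbabilityMeasure_deletionLaw n h0 h1
  have : IsProbabilityMeasure (columnLaw M δ) := by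
    unfold columnLaw
    infer_instance
  refine Measure.ext_of_singleton fun f => ?_
  set ω : Outcome n M := (fun i => (f i).1, fun i => (f i).2.1, fun m i => (f i).2.2 m) with hω
  have hf : columns ω = f := rfl
  have hpre : columns ⁻¹' {f} = {ω} := by
    ext ω'
    simp only [Set.mem_preimage, Set.mem_singleton_iff]
    rw [← hf]
    exact columns_injective.eq_iff
  rw [Measure.map_apply (measurable_of_countable _) (measurableSet_singleton f), hpre,
    Measure.pi_singleton, outcomeLaw]
  have hu : ∀ x : Fin n → Bool, uniformOn (Set.univ : Set (Fin n → Bool)) {x} =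
      ∏ i : Fin n, uniformOn (Set.univ : Set Bool) {x i} := by
    intro x
    simp only [uniformOn_univ, Measure.count_singleton, Finset.prod_const, Finset.card_univ,
      Fintype.card_fin, Fintype.card_bool, Fintype.card_pi]
    rw [one_div, one_div, ← ENNReal.inv_pow]
    norm_cast
  have hsing : ({ω} : Set (Outcome n M)) = {ω.1} ×ˢ ({ω.2.1} ×ˢ {ω.2.2}) := by
    simp [Set.singleton_prod_singleton]
  have hcol : ∀ i, columnLaw M δ {f i} = uniformOn (Set.univ : Set Bool) {ω.1 i} *
      (flagLaw δ {ω.2.1 i} * ∏ m : Fin M, flagLaw δ {ω.2.2 m i}) := by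
    intro i
    have : ({f i} : Set (Bool × Bool × (Fin M → Bool))) =
        {ω.1 i} ×ˢ ({ω.2.1 i} ×ˢ {fun m => ω.2.2 m i}) := by
      rw [Set.singleton_prod_singleton, Set.singleton_prod_singleton]
    rw [this, columnLaw, Measure.prod_prod, Measure.prod_prod, Measure.pi_singleton]
  rw [hsing, Measure.prod_prod, Measure.prod_prod, Measure.pi_singleton, hu]
  simp_rw [hcol, deletionLaw, Measure.pi_singleton]
  rw [Finset.prod_mul_distrib, Finset.prod_mul_distrib, Finset.prod_comm]

theorem outcomeLaw_biInter_le (h0 : 0 ≤ δ) (h1 : δ ≤ 1) {κ : Type*} [DecidableEq κ]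
    (W : κ → Finset (Fin n)) (B : κ → Outcome n M → Prop) (p : ℝ) (T : Finset κ)
    (hW : ∀ j ∈ T, ∀ k ∈ T, j ≠ k → Disjoint (W j) (W k))
    (hB : ∀ j ∈ T, ∀ ω ω' : Outcome n M, (∀ i ∈ W j, columns ω i = columns ω' i) →
      B j ω → B j ω')
    (hp : ∀ j ∈ T, (outcomeLaw n M δ).real {ω | B j ω} ≤ p) :
    (outcomeLaw n M δ).real {ω | ∀ j ∈ T, B j ω} ≤ p ^ T.card := by
  have := isProbabilityMeasure_flagLaw h0 h1
  have : IsProbabilityMeasure (columnLaw M δ) := by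
    unfold columnLaw
    infer_instance
  have hmap : ∀ A : Set (Outcome n M), (outcomeLaw n M δ).real A =
      (Measure.pi fun _ : Fin n => columnLaw M δ).real (columns '' A) := by
    intro A
    rw [← map_columns h0 h1, Measure.real, Measure.real,
      Measure.map_apply (measurable_of_countable _) MeasurableSet.of_discrete,
      Set.preimage_image_eq _ columns_injective]
  have himg : columns '' {ω : Outcome n M | ∀ j ∈ T, B j ω} ⊆
      {a | ∀ j ∈ T, a ∈ columns '' {ω | B j ω}} := by
    rintro _ ⟨ω, hω, rfl⟩ j hj
    exact ⟨ω, hω j hj, rfl⟩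
  rw [hmap]
  refine (measureReal_mono himg (measure_ne_top _ _)).trans
    (pi_biInter_le (columnLaw M δ) W _ p T hW ?_ fun j hj => (hmap _).symm.trans_le (hp j hj))
  rintro j hj _ b hab ⟨ω, hω, rfl⟩
  refine ⟨(fun i => (b i).1, fun i => (b i).2.1, fun m i => (b i).2.2 m), ?_, rfl⟩
  exact hB j hj ω _ hab hω

/-! ### Locality and the number of bad locations -/

theorem delIn_congr {D D' : Deletions n} {a b : ℕ}
    (h : ∀ i : Fin n, a ≤ (i : ℕ) → (i : ℕ) < b → D i = D' i) : delIn D a b = delIn D' a b := by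
  unfold delIn
  congr 1
  ext i
  simp only [Finset.mem_filter, Finset.mem_univ, true_and]
  constructor
  · rintro ⟨h1, h2, h3⟩
    exact ⟨h1, h2, (h i h1 h2) ▸ h3⟩
  · rintro ⟨h1, h2, h3⟩
    exact ⟨h1, h2, (h i h1 h2).symm ▸ h3⟩

theorem Sparse.congr {D D' : Deletions n} {t lo hi : ℕ}
    (h : ∀ i : Fin n, lo ≤ (i : ℕ) → (i : ℕ) < hi + 4 * t → D i = D' i) (hD : Sparse D t lo hi) :
    Sparse D' t lo hi := by
  intro c h1 h2
  rw [← delIn_congr (D := D) fun i hi1 hi2 => h i (by omega) (by omega)]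
  exact hD c h1 h2

/-- Whether a location is bad depends only on the bits and the flags nearby. -/
theorem BadNear.congr {h S R j : ℕ} (hS : 1 ≤ S) (hR : 6 * windowLen h S ≤ R) {ω ω' : Outcome n M}
    (hω : ∀ i ∈ window n (j - R) (j + R), columns ω i = columns ω' i)
    (hb : BadNear h S ω.1 ω.2.1 ω.2.2 j) : BadNear h S ω'.1 ω'.2.1 ω'.2.2 j := by
  have hx : ∀ i : Fin n, j - R ≤ (i : ℕ) → (i : ℕ) < j + R → ω.1 i = ω'.1 i := fun i h1 h2 =>
    congrArg Prod.fst (hω i (mem_window.2 ⟨h1, h2⟩))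
  have hE : ∀ i : Fin n, j - R ≤ (i : ℕ) → (i : ℕ) < j + R → ω.2.1 i = ω'.2.1 i := fun i h1 h2 =>
    congrArg (fun c => c.2.1) (hω i (mem_window.2 ⟨h1, h2⟩))
  have hD : ∀ m, ∀ i : Fin n, j - R ≤ (i : ℕ) → (i : ℕ) < j + R → ω.2.2 m i = ω'.2.2 m i :=
    fun m i h1 h2 => congrFun (congrArg (fun c => c.2.2) (hω i (mem_window.2 ⟨h1, h2⟩))) m
  have h1S := windowLen_mono h hS
  have hpos : 0 < windowLen h 1 := by simp [windowLen]
  rcases hb with ⟨s, hs, hb⟩ | hb | hb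
  · have hsS := windowLen_mono h hs.2.le
    have h1s := windowLen_mono h hs.1
    refine Or.inl ⟨s, hs, ?_⟩
    rcases hb with hb | ⟨m, hb⟩ | ⟨c, hc1, hc2, f, g, hf, hg, hfg⟩
    · refine Or.inl fun hsp => hb (hsp.congr fun i h1 h2 => (hE i (by omega) (by omega)).symm)
    · refine Or.inr (Or.inl ⟨m, fun hsp => hb (hsp.congr fun i h1 h2 =>
        (hD m i (by omega) (by omega)).symm)⟩)
    · refine Or.inr (Or.inr ⟨c, hc1, hc2, f, g, hf, hg, fun r => ?_⟩)
      obtain ⟨h1, h2, h3, h4⟩ := hfg r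
      refine ⟨h1, h2, h3, ?_⟩
      rw [← hx (f r) (by omega) (by omega), ← hx (g r) (by omega) (by omega), h4]
  · refine Or.inr (Or.inl ?_)
    have hd : dirty ω'.2.2 (j - 2 * windowLen h 1) (j + 2 * windowLen h 1) =
        dirty ω.2.2 (j - 2 * windowLen h 1) (j + 2 * windowLen h 1) := by
      unfold dirty
      congr 1
      funext m
      rw [delIn_congr fun i h1 h2 => (hD m i (by omega) (by omega)).symm]
    rwa [hd]
  · obtain ⟨c, c', hc, hc', hne, f, g, hfg⟩ := hb
    refine Or.inr (Or.inr ⟨c, c', hc, hc', hne, f, g, fun r => ?_⟩)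
    obtain ⟨h1, h2, h3⟩ := hfg r
    have hr := r.2
    refine ⟨h1, h2, ?_⟩
    rw [← hx (f r) (by omega) (by omega), ← hx (g r) (by omega) (by omega), h3]

theorem card_residue_le (n L c : ℕ) :
    (Finset.univ.filter fun j : Fin n => (j : ℕ) % L = c).card ≤ n / L + 1 := by
  rw [← Finset.card_range (n / L + 1)]
  refine Finset.card_le_card_of_injOn (fun j => (j : ℕ) / L) ?_ ?_
  · intro j _
    simp only [Finset.coe_range, Set.mem_Iio]
    exact Nat.lt_succ_of_le (Nat.div_le_div_right j.isLt.le)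
  · intro j hj k hk hjk
    have h1 := (Finset.mem_filter.1 hj).2
    have h2 := (Finset.mem_filter.1 hk).2
    have h3 := Nat.div_add_mod (j : ℕ) L
    have h4 := Nat.div_add_mod (k : ℕ) L
    dsimp only at hjk
    rw [h1, hjk] at h3
    rw [h2] at h4
    exact Fin.ext (h3.symm.trans h4)

/-- Events that depend on windows of radius `R` are independent along each residue class
modulo `2 R`. If many of them occur, then many occur in one class. -/
theorem outcomeLaw_card_ge_le (h0 : 0 ≤ δ) (h1 : δ ≤ 1) {R : ℕ} (hR : 0 < R)
    (B : Fin n → Outcome n M → Prop) [∀ ω, DecidablePred fun j => B j ω] (p : ℝ) (hp0 : 0 ≤ p)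
    (hB : ∀ j : Fin n, ∀ ω ω' : Outcome n M,
      (∀ i ∈ window n (j - R) (j + R), columns ω i = columns ω' i) → B j ω → B j ω')
    (hp : ∀ j, (outcomeLaw n M δ).real {ω | B j ω} ≤ p) (r : ℕ) :
    (outcomeLaw n M δ).real {ω | 2 * R * r < (Finset.univ.filter fun j => B j ω).card} ≤
      (2 * R : ℕ) * ((n / (2 * R) + 1).choose r * p ^ r) := by
  have := isProbabilityMeasure_outcomeLaw n M h0 h1
  have hL : 0 < 2 * R := by omega
  nth_rewrite 2 [← Finset.card_range (2 * R)]
  refine measureReal_le_card_mul (outcomeLaw n M δ) (Finset.range (2 * R)) (B := fun c => {ω | r ≤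
    ((Finset.univ.filter fun j : Fin n => (j : ℕ) % (2 * R) = c).filter fun j => B j ω).card}) ?_
    fun c _ => ?_
  · intro ω hω
    obtain ⟨c, hc, hcr⟩ := Finset.exists_lt_card_fiber_of_mul_lt_card_of_maps_to
      (s := Finset.univ.filter fun j => B j ω) (t := Finset.range (2 * R))
      (f := fun j : Fin n => (j : ℕ) % (2 * R)) (n := r)
      (fun j _ => Finset.mem_range.2 (Nat.mod_lt _ hL))
      (by rw [Finset.card_range]; exact hω)
    simp only [Set.mem_iUnion]
    refine ⟨c, hc, ?_⟩
    rw [Set.mem_ofPred_eq, Finset.filter_comm]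
    exact hcr.le
  · refine (measureReal_le_card_filter (outcomeLaw n M δ) _ B r (p ^ r) fun T hT hTr => ?_).trans ?_
    · rw [← hTr]
      refine outcomeLaw_biInter_le h0 h1 (fun j : Fin n => window n (j - R) (j + R)) B p T ?_
        (fun j _ => hB j) fun j _ => hp j
      intro j hj k hk hjk
      have hj' := (Finset.mem_filter.1 (hT hj)).2
      have hk' := (Finset.mem_filter.1 (hT hk)).2
      have h3 := Nat.div_add_mod (j : ℕ) (2 * R)
      have h4 := Nat.div_add_mod (k : ℕ) (2 * R)
      have hne : (j : ℕ) / (2 * R) ≠ (k : ℕ) / (2 * R) := by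
        intro h
        rw [h, hj'] at h3
        rw [hk'] at h4
        exact hjk (Fin.ext (h3.symm.trans h4))
      rw [Finset.disjoint_left]
      intro i hi hi'
      rw [mem_window] at hi hi'
      rcases lt_or_gt_of_ne hne with h | h
      · have := Nat.mul_le_mul_left (2 * R) h
        rw [Nat.mul_succ] at this
        omega
      · have := Nat.mul_le_mul_left (2 * R) h
        rw [Nat.mul_succ] at this
        omega
    · gcongr
      exact card_residue_le n (2 * R) c

/-! ### Probability of a bad location -/

theorem two_pow_mul_half_pow_le {a b c : ℕ} (h : c + a ≤ b) :
    (2 : ℝ) ^ a * (1 / 2) ^ b ≤ (1 / 2) ^ c := by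
  calc (2 : ℝ) ^ a * (1 / 2) ^ b ≤ 2 ^ a * (1 / 2) ^ (c + a) := by
        gcongr 2 ^ a * ?_
        exact pow_le_pow_of_le_one (by norm_num) (by norm_num) h
    _ = (2 * (1 / 2)) ^ a * (1 / 2) ^ c := by rw [pow_add, mul_pow]; ring
    _ = (1 / 2) ^ c := by norm_num

theorem le_two_pow_div {t : ℕ} (ht : 2 ^ 20 ≤ t) : (t : ℝ) ≤ 2 ^ (t / 1000) := by
  have key : ∀ q, 14 ≤ q → 1024 * (q + 1) ≤ 2 ^ q := by
    intro q hq
    induction q, hq using Nat.le_induction with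
    | base => norm_num
    | succ q _ ih =>
      rw [pow_succ]
      omega
  have h1 := key (t / 1000) (by omega)
  have h2 : t ≤ 2 ^ (t / 1000) := by omega
  exact_mod_cast h2

theorem sparse_term_le {t : ℕ} (ht : 2 ^ 20 ≤ t) (hδ0 : 0 ≤ δ) (hδ : δ ≤ (1 / 2) ^ 1000) :
    ((4 * t).choose (t / 400 + 1) : ℝ) * δ ^ (t / 400 + 1) ≤ (1 / 2) ^ (2 * t) := by
  set r := t / 400 + 1 with hr
  have hr0 : 0 < r := by omega
  have hr1 : (0 : ℝ) < r := by exact_mod_cast hr0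
  have h1 := choose_le_pow (4 * t) r hr0
  have h2 : (3 * (4 * t : ℕ) / r : ℝ) ≤ 2 ^ 13 := by
    rw [div_le_iff₀ hr1]
    have : 3 * (4 * t) ≤ 2 ^ 13 * r := by omega
    exact_mod_cast this
  calc _ ≤ ((2 : ℝ) ^ 13) ^ r * ((1 / 2) ^ 1000) ^ r := by
        gcongr
        exact h1.trans (by gcongr)
    _ = (2 : ℝ) ^ (13 * r) * (1 / 2) ^ (1000 * r) := by rw [pow_mul, pow_mul]
    _ ≤ _ := two_pow_mul_half_pow_le (by omega)

theorem repeats_term_le {t : ℕ} (ht : 2 ^ 20 ≤ t) :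
    ((t + t / 40).choose (t - t / 50) : ℝ) ^ 2 * (1 / 2) ^ (t - t / 50) ≤ (1 / 2) ^ (t / 3) := by
  have h1 := choose_le_two_pow (t + t / 40) (t / 40 + t / 50) ((t + t / 40) / 16 + 1) (by omega)
  have h2 : (t + t / 40).choose (t - t / 50) = (t + t / 40).choose (t / 40 + t / 50) := by
    rw [← Nat.choose_symm (show t - t / 50 ≤ t + t / 40 by omega)]
    congr 1
    omega
  rw [h2]
  calc _ ≤ ((2 : ℝ) ^ (5 * (t / 40 + t / 50) + ((t + t / 40) / 16 + 1))) ^ 2 *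
        (1 / 2) ^ (t - t / 50) := by gcongr
    _ = (2 : ℝ) ^ ((5 * (t / 40 + t / 50) + ((t + t / 40) / 16 + 1)) * 2) *
        (1 / 2) ^ (t - t / 50) := by rw [← pow_mul]
    _ ≤ _ := two_pow_mul_half_pow_le (by omega)

/-- Scale `t` is bad with probability exponentially small in `t`. -/
theorem outcomeLaw_badLevel_le' {t : ℕ} (ht : 2 ^ 20 ≤ t) (hδ0 : 0 ≤ δ) (hδ : δ ≤ (1 / 2) ^ 1000)
    (hM : (M : ℝ) + 1 ≤ 2 ^ t) (j lo hi : ℕ) :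
    (outcomeLaw n M δ).real {ω | BadLevel ω.1 ω.2.1 ω.2.2 t j lo hi} ≤
      (hi - lo : ℕ) * (2 * (1 / 2) ^ (t / 3)) := by
  have hδ1 : δ ≤ 1 := hδ.trans (pow_le_one₀ (by norm_num) (by norm_num))
  refine (outcomeLaw_badLevel_le hδ0 hδ1 t j lo hi).trans ?_
  gcongr
  have h1 : ((M : ℝ) + 1) * ((4 * t).choose (t / 400 + 1) * δ ^ (t / 400 + 1)) ≤
      2 ^ t * (1 / 2) ^ (2 * t) := by
    gcongr
    exact sparse_term_le ht hδ0 hδ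
  have h2 := two_pow_mul_half_pow_le (show t / 3 + t ≤ 2 * t by omega)
  have h3 := repeats_term_le ht
  linarith

/-- The probability of a local obstruction, where `q` bounds the probability that many traces have
a deletion near `j`. -/
theorem outcomeLaw_badNear_le {h S j : ℕ} {q : ℝ} (ht : 2 ^ 20 ≤ windowLen h 1)
    (hδ0 : 0 ≤ δ) (hδ : δ ≤ (1 / 2) ^ 1000) (hM : (M : ℝ) + 1 ≤ 2 ^ windowLen h 1)
    (hq : (M.choose (M / 20 + 1) : ℝ) * ((4 * windowLen h 1 : ℕ) * δ) ^ (M / 20 + 1) ≤ q) :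
    (outcomeLaw n M δ).real {ω | BadNear h S ω.1 ω.2.1 ω.2.2 j} ≤
      3 * (1 / 2) ^ (windowLen h 1 / 4) + q := by
  have hδ1 : δ ≤ 1 := hδ.trans (pow_le_one₀ (by norm_num) (by norm_num))
  have := isProbabilityMeasure_outcomeLaw n M hδ0 hδ1
  set t := windowLen h 1 with htdef
  have hsub : {ω : Outcome n M | BadNear h S ω.1 ω.2.1 ω.2.2 j} ⊆
      (⋃ s ∈ Finset.range (S - 1), {ω | BadLevel ω.1 ω.2.1 ω.2.2 (windowLen h (s + 1)) j
        (j - 2 * windowLen h (s + 1)) (j + 2 * windowLen h (s + 1))}) ∪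
      ({ω | ω.2.2 ∈ {D | M / 20 + 1 ≤ (dirty D (j - 2 * t) (j - 2 * t + 4 * t)).card}} ∪
        {ω | ω.1 ∈ {x | SelfOverlaps x ((9 * t + 9) / 10) (j - 2 * t) (j + 2 * t)}}) := by
    rintro ω (⟨s, hs, hb⟩ | hb | hb)
    · refine Or.inl ?_
      simp only [Set.mem_iUnion, Finset.mem_range]
      obtain ⟨s, rfl⟩ := Nat.exists_eq_add_of_le' hs.1
      exact ⟨s, by omega, hb⟩
    · refine Or.inr (Or.inl ?_)
      have h1 : dirty ω.2.2 (j - 2 * t) (j + 2 * t) ⊆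
          dirty ω.2.2 (j - 2 * t) (j - 2 * t + 4 * t) := by
        intro m hm
        simp only [dirty, Finset.mem_filter, Finset.mem_univ, true_and] at hm ⊢
        exact hm.trans_le (delIn_mono _ le_rfl (by omega))
      have h2 := Finset.card_le_card h1
      rw [← htdef] at hb
      show M / 20 + 1 ≤ (dirty ω.2.2 (j - 2 * t) (j - 2 * t + 4 * t)).card
      omega
    · exact Or.inr (Or.inr hb)
  have hlev : ∀ s ∈ Finset.range (S - 1), (outcomeLaw n M δ).real
      {ω | BadLevel ω.1 ω.2.1 ω.2.2 (windowLen h (s + 1)) j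
        (j - 2 * windowLen h (s + 1)) (j + 2 * windowLen h (s + 1))} ≤
      (1 / 2) ^ (t / 4 + 1) * (1 / 2) ^ s := by
    intro s _
    set t' := windowLen h (s + 1) with ht'
    -- Growth of the windows, to sum over the scales.
    have hgrow : t + 4 * s ≤ t' := by
      have h1 : ∀ s : ℕ, t + 4 * s ≤ windowLen h (s + 1) := by
        intro s
        induction s with
        | zero => simp [htdef]
        | succ s ih =>
          rw [windowLen_succ h (by omega)]
          omega
      exact h1 s
    have hM' : (M : ℝ) + 1 ≤ 2 ^ t' := hM.trans (by gcongr <;> norm_num; omega)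
    refine (outcomeLaw_badLevel_le' (n := n) (by omega) hδ0 hδ hM' j _ _).trans ?_
    have h2 := le_two_pow_div (t := t') (by omega)
    have h3 : ((j + 2 * t' - (j - 2 * t') : ℕ) : ℝ) ≤ 4 * t' := by
      have : j + 2 * t' - (j - 2 * t') ≤ 4 * t' := by omega
      exact_mod_cast this
    calc _ ≤ 4 * (2 : ℝ) ^ (t' / 1000) * (2 * (1 / 2) ^ (t' / 3)) := by
          gcongr
          linarith
      _ = (2 : ℝ) ^ (t' / 1000 + 3) * (1 / 2) ^ (t' / 3) := by rw [pow_add]; ring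
      _ ≤ (1 / 2) ^ (t / 4 + 1 + s) := two_pow_mul_half_pow_le (by omega)
      _ = _ := by rw [pow_add]
  have hlevs : (outcomeLaw n M δ).real (⋃ s ∈ Finset.range (S - 1),
      {ω | BadLevel ω.1 ω.2.1 ω.2.2 (windowLen h (s + 1)) j
        (j - 2 * windowLen h (s + 1)) (j + 2 * windowLen h (s + 1))}) ≤ 2 * (1 / 2) ^ (t / 4) := by
    refine (measureReal_biUnion_finset_le _ _).trans ((Finset.sum_le_sum hlev).trans ?_)
    rw [← Finset.mul_sum]
    have h1 := sum_geometric_two_le (S - 1)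
    calc _ ≤ (1 / 2 : ℝ) ^ (t / 4 + 1) * 2 := by gcongr
      _ ≤ _ := by
        rw [pow_succ]
        have : (0 : ℝ) ≤ (1 / 2) ^ (t / 4) := by positivity
        linarith
  have hdirty := (outcomeLaw_traces (n := n) (M := M) hδ0 hδ1
    {D | M / 20 + 1 ≤ (dirty D (j - 2 * t) (j - 2 * t + 4 * t)).card}).trans_le
    ((pi_deletionLaw_dirty_ge hδ0 hδ1 _ _ _).trans hq)
  have hself := (outcomeLaw_fst (n := n) (M := M) hδ0 hδ1
    {x | SelfOverlaps x ((9 * t + 9) / 10) (j - 2 * t) (j + 2 * t)}).trans_le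
    (uniformOn_selfOverlaps_le _ _ _)
  have hself' : ((j + 2 * t - (j - 2 * t) : ℕ) : ℝ) ^ 2 * (1 / 2) ^ ((9 * t + 9) / 10) ≤
      (1 / 2) ^ (t / 4) := by
    have h2 := le_two_pow_div (t := t) ht
    have h3 : ((j + 2 * t - (j - 2 * t) : ℕ) : ℝ) ≤ 4 * 2 ^ (t / 1000) := by
      have : j + 2 * t - (j - 2 * t) ≤ 4 * t := by omega
      have h4 : ((j + 2 * t - (j - 2 * t) : ℕ) : ℝ) ≤ 4 * t := by exact_mod_cast this
      linarith
    calc _ ≤ (4 * (2 : ℝ) ^ (t / 1000)) ^ 2 * (1 / 2) ^ ((9 * t + 9) / 10) := by gcongr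
      _ = (2 : ℝ) ^ (t / 1000 * 2 + 4) * (1 / 2) ^ ((9 * t + 9) / 10) := by
          rw [pow_add, pow_mul]; ring
      _ ≤ _ := two_pow_mul_half_pow_le (by omega)
  refine (measureReal_mono hsub (measure_ne_top _ _)).trans ((measureReal_union_le _ _).trans
    ((add_le_add hlevs ((measureReal_union_le _ _).trans (add_le_add hdirty
      (hself.trans hself')))).trans ?_))
  linarith

variable {K : ℝ}

/-! ### Parameters -/

theorem one_add_le_two_rpow {p : ℝ} (hp : 1 ≤ p) : 1 + p ≤ 2 ^ p := by
  have := one_add_mul_self_le_rpow_one_add (s := 1) (by norm_num) hp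
  rw [mul_one] at this
  norm_num at this ⊢
  exact this

theorem le_two_rpow_half {p : ℝ} (hp : 16 ≤ p) : p ≤ 2 ^ (p / 2) := by
  have h1 := one_add_le_two_rpow (p := p / 4) (by linarith)
  have h2 : (2 : ℝ) ^ (p / 2) = 2 ^ (p / 4) * 2 ^ (p / 4) := by
    rw [← Real.rpow_add (by norm_num)]
    ring_nf
  rw [h2]
  nlinarith

theorem half_pow_eq_rpow (k : ℕ) : (1 / 2 : ℝ) ^ k = 2 ^ (-(k : ℝ)) := by
  rw [Real.rpow_neg (by norm_num), Real.rpow_natCast, one_div, inv_pow]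

/-- The regime of the parameters `K`, `δ` and `M`. -/
structure Regime (K δ : ℝ) (M : ℕ) : Prop where
  K_ge : (2 : ℝ) ^ 1000 ≤ K
  δ_pos : 0 < δ
  δ_lt : δ < 1 / (K * M)
  sq_le : K ^ 2 ≤ M

namespace Regime

theorem big_le_K (hr : Regime K δ M) : 10 ^ 12 ≤ K := by
  have h1 : (2 : ℝ) ^ 40 ≤ 2 ^ 1000 := pow_le_pow_right₀ (by norm_num) (by norm_num)
  refine le_trans ?_ (h1.trans hr.K_ge)
  norm_num

theorem K_pos (hr : Regime K δ M) : 0 < K := lt_of_lt_of_le (by norm_num) hr.big_le_K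

theorem M_pos (hr : Regime K δ M) : (0 : ℝ) < M :=
  lt_of_lt_of_le (pow_pos hr.K_pos 2) hr.sq_le

theorem one_le_M (hr : Regime K δ M) : (1 : ℝ) ≤ M := by
  exact_mod_cast (show 0 < M by exact_mod_cast hr.M_pos)

theorem δ_le (hr : Regime K δ M) : δ ≤ (1 / 2) ^ 1000 := by
  have h1 : (2 : ℝ) ^ 1000 ≤ K * M :=
    hr.K_ge.trans (le_mul_of_one_le_right hr.K_pos.le hr.one_le_M)
  refine hr.δ_lt.le.trans ?_
  rw [one_div_pow]
  exact one_div_le_one_div_of_le (by positivity) h1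

theorem K_le_ratio (hr : Regime K δ M) : K ≤ M / K := by
  rw [le_div_iff₀ hr.K_pos, ← pow_two]
  exact hr.sq_le

theorem log_ge (hr : Regime K δ M) : 1000 ≤ Real.logb 2 (1 / (δ * M)) := by
  have hK := hr.K_pos
  have hM := hr.M_pos
  have hδ := hr.δ_pos
  rw [Real.le_logb_iff_rpow_le (by norm_num) (by positivity)]
  have h1 : (2 : ℝ) ^ (1000 : ℝ) = 2 ^ 1000 := by
    rw [← Real.rpow_natCast]
    norm_num
  rw [h1]
  refine hr.K_ge.trans ?_
  rw [le_div_iff₀ (by positivity)]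
  have h2 := hr.δ_lt
  rw [lt_div_iff₀ (by positivity)] at h2
  linarith

theorem ratio_le_scaleH (hr : Regime K δ M) : 1000 * (M / K) ≤ scaleH K δ M := by
  unfold scaleH
  rw [mul_comm]
  have := hr.log_ge
  have h1 : 0 ≤ M / K := hr.K_pos.le.trans hr.K_le_ratio
  gcongr

theorem big_le_scaleH (hr : Regime K δ M) : 10 ^ 15 ≤ scaleH K δ M := by
  have h1 := hr.ratio_le_scaleH
  have h2 := hr.K_le_ratio
  have h3 := hr.big_le_K
  linarith

theorem M_le_sq (hr : Regime K δ M) : (M : ℝ) ≤ scaleH K δ M ^ 2 := by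
  have h1 := hr.ratio_le_scaleH
  have h2 := hr.K_le_ratio
  have h3 := hr.K_pos
  have h4 : (M : ℝ) = K * (M / K) := by field_simp
  nlinarith

theorem le_windowLen (K δ : ℝ) (M : ℕ) :
    2 * scaleH K δ M + 1 ≤ windowLen ⌈scaleH K δ M⌉₊ 1 := by
  have h1 := Nat.le_ceil (scaleH K δ M)
  rw [windowLen_one]
  push_cast
  linarith

theorem windowLen_le (hr : Regime K δ M) :
    (windowLen ⌈scaleH K δ M⌉₊ 1 : ℝ) ≤ 2 * scaleH K δ M + 3 := by
  have h0 := hr.big_le_scaleH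
  have h1 := Nat.ceil_lt_add_one (a := scaleH K δ M) (by linarith)
  rw [windowLen_one]
  push_cast
  linarith

theorem big_le_windowLen (hr : Regime K δ M) : 2 ^ 20 ≤ windowLen ⌈scaleH K δ M⌉₊ 1 := by
  have h0 := hr.big_le_scaleH
  have h1 := le_windowLen K δ M
  have h2 : ((2 ^ 20 : ℕ) : ℝ) ≤ windowLen ⌈scaleH K δ M⌉₊ 1 := by
    push_cast
    linarith
  exact_mod_cast h2

theorem M_succ_le (hr : Regime K δ M) : (M : ℝ) + 1 ≤ 2 ^ windowLen ⌈scaleH K δ M⌉₊ 1 := by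
  have h0 := hr.big_le_scaleH
  have h1 := le_windowLen K δ M
  have h2 := le_two_pow_div hr.big_le_windowLen
  have h3 := hr.M_le_sq
  set t := windowLen ⌈scaleH K δ M⌉₊ 1
  calc (M : ℝ) + 1 ≤ (t : ℝ) ^ 2 := by nlinarith
    _ ≤ (2 ^ (t / 1000)) ^ 2 := by gcongr
    _ = 2 ^ (t / 1000 * 2) := by rw [pow_mul]
    _ ≤ 2 ^ t := by
      gcongr
      · norm_num
      · omega

/-- It is unlikely that a fraction `1 / 20` of the traces have a deletion near a given location. -/
theorem dirty_le (hr : Regime K δ M) :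
    (M.choose (M / 20 + 1) : ℝ) *
      ((4 * windowLen ⌈scaleH K δ M⌉₊ 1 : ℕ) * δ) ^ (M / 20 + 1) ≤ 2 ^ (-scaleH K δ M) := by
  have hK := hr.K_pos
  have hK' := hr.big_le_K
  have hM := hr.M_pos
  have hδ := hr.δ_pos
  have hlog := hr.log_ge
  have h0 := hr.big_le_scaleH
  have h1 := hr.windowLen_le
  set t := windowLen ⌈scaleH K δ M⌉₊ 1
  set v := Real.logb 2 (1 / (δ * M)) with hv
  have hH : scaleH K δ M = M / K * v := rfl
  obtain ⟨r, hrdef⟩ : ∃ r, r = M / 20 + 1 := ⟨_, rfl⟩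
  rw [← hrdef]
  have hr0 : (0 : ℝ) < r := by
    rw [hrdef]
    positivity
  have hMr : (M : ℝ) ≤ 20 * r := by
    have : M ≤ 20 * r := by omega
    exact_mod_cast this
  have h2 := choose_le_pow M r (by omega)
  have h3 : (3 * M / r : ℝ) ≤ 60 := by
    rw [div_le_iff₀ hr0]
    linarith
  have h4 : δ * M = 2 ^ (-v) := by
    rw [Real.rpow_neg (by norm_num), hv, Real.rpow_logb (by norm_num) (by norm_num)
      (by positivity), one_div, inv_inv]
  have h5 : scaleH K δ M * δ = v * 2 ^ (-v) / K := by
    rw [hH, ← h4]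
    ring
  have h6 : 60 * ((4 * t : ℕ) * δ) ≤ 2 ^ (-(v / 2)) := by
    have h7 : (60 : ℝ) * ((4 * t : ℕ) * δ) ≤ 720 * (scaleH K δ M * δ) := by
      push_cast
      nlinarith
    have h8 : (2 : ℝ) ^ (-v) = 2 ^ (-(v / 2)) * 2 ^ (-(v / 2)) := by
      rw [← Real.rpow_add (by norm_num)]
      ring_nf
    have h9 := le_two_rpow_half (p := v) (by linarith)
    have h10 : v * 2 ^ (-(v / 2)) ≤ 1 := by
      rw [Real.rpow_neg (by norm_num), ← div_eq_mul_inv, div_le_one (by positivity)]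
      exact h9
    have hpos : (0 : ℝ) < 2 ^ (-(v / 2)) := by positivity
    rw [h5, h8] at h7
    refine h7.trans ?_
    rw [← mul_div_assoc, div_le_iff₀ hK]
    have h11 : v * (2 ^ (-(v / 2)) * 2 ^ (-(v / 2))) ≤ 2 ^ (-(v / 2)) := by
      rw [← mul_assoc]
      exact mul_le_of_le_one_left hpos.le h10
    nlinarith
  calc (M.choose r : ℝ) * ((4 * t : ℕ) * δ) ^ r ≤ 60 ^ r * ((4 * t : ℕ) * δ) ^ r := by
        gcongr
        exact h2.trans (by gcongr)
    _ = (60 * ((4 * t : ℕ) * δ)) ^ r := (mul_pow _ _ _).symm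
    _ ≤ (2 ^ (-(v / 2))) ^ r := by gcongr
    _ = 2 ^ (-(v / 2) * r) := by rw [Real.rpow_mul (by norm_num), Real.rpow_natCast]
    _ ≤ 2 ^ (-scaleH K δ M) := by
        refine Real.rpow_le_rpow_of_exponent_le (by norm_num) ?_
        have h7 : M / K ≤ r / 2 := by
          rw [div_le_iff₀ hK]
          nlinarith
        rw [hH]
        nlinarith

/-- The probability of a local obstruction is well below the fraction of failures allowed. -/
theorem badNear_le (hr : Regime K δ M) (S j : ℕ) :
    (outcomeLaw n M δ).real {ω | BadNear ⌈scaleH K δ M⌉₊ S ω.1 ω.2.1 ω.2.2 j} ≤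
      2 ^ (-0.3 * scaleH K δ M) := by
  refine (outcomeLaw_badNear_le hr.big_le_windowLen hr.δ_pos.le hr.δ_le hr.M_succ_le
    hr.dirty_le).trans ?_
  have h0 := hr.big_le_scaleH
  have h1 := le_windowLen K δ M
  set t := windowLen ⌈scaleH K δ M⌉₊ 1
  have h2 : (t : ℝ) / 4 - 1 ≤ ((t / 4 : ℕ) : ℝ) := by
    have : t ≤ 4 * (t / 4) + 4 := by omega
    have h3 : (t : ℝ) ≤ 4 * ((t / 4 : ℕ) : ℝ) + 4 := by exact_mod_cast this
    linarith
  have h3 : (1 / 2 : ℝ) ^ (t / 4) ≤ 2 ^ (-0.3 * scaleH K δ M - 2) := by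
    rw [half_pow_eq_rpow]
    refine Real.rpow_le_rpow_of_exponent_le (by norm_num) ?_
    linarith
  have h4 : (2 : ℝ) ^ (-scaleH K δ M) ≤ 2 ^ (-0.3 * scaleH K δ M - 2) := by
    refine Real.rpow_le_rpow_of_exponent_le (by norm_num) ?_
    linarith
  have h5 : (2 : ℝ) ^ (-0.3 * scaleH K δ M - 2) = 2 ^ (-0.3 * scaleH K δ M) / 4 := by
    rw [Real.rpow_sub (by norm_num)]
    norm_num
  rw [h5] at h3 h4
  linarith

end Regime

/-! ### The number of levels -/

theorem tauC_eq : tauC = 500 := by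
  norm_num [tauC, gammaC]

/-- The top window has length between `500 log n` and `1500 log n`, unless the first window is
longer. -/
theorem numLevels_spec (n h : ℕ) :
    1 ≤ numLevels n h ∧ 500 * Real.logb 2 n ≤ windowLen h (numLevels n h) ∧
      (windowLen h (numLevels n h) : ℝ) ≤ max (windowLen h 1 : ℝ) (1500 * Real.logb 2 n) := by
  have hne : {s | 1 ≤ s ∧ tauC * Real.logb 2 n ≤ windowLen h s}.Nonempty := by
    obtain ⟨s, hs⟩ := exists_nat_ge (tauC * Real.logb 2 n)
    refine ⟨s + 1, by omega, hs.trans ?_⟩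
    have h1 : s ≤ windowLen h (s + 1) := by
      unfold windowLen
      rw [Nat.add_sub_cancel]
      exact (Nat.lt_pow_self (by norm_num : 1 < 3)).le.trans (Nat.le_mul_of_pos_right _ (by omega))
    exact_mod_cast h1
  have hmem := Nat.sInf_mem hne
  change numLevels n h ∈ {s | 1 ≤ s ∧ tauC * Real.logb 2 n ≤ windowLen h s} at hmem
  obtain ⟨h1, h2⟩ := hmem
  rw [tauC_eq] at h2
  refine ⟨h1, h2, ?_⟩
  rcases Nat.lt_or_ge 1 (numLevels n h) with h3 | h3
  · refine le_max_of_le_right ?_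
    have h4 : numLevels n h - 1 ∉ {s | 1 ≤ s ∧ tauC * Real.logb 2 n ≤ windowLen h s} :=
      Nat.notMem_of_lt_sInf (show numLevels n h - 1 < numLevels n h by omega)
    have h5 : (windowLen h (numLevels n h - 1) : ℝ) < 500 * Real.logb 2 n := by
      rw [← tauC_eq]
      by_contra hc
      exact h4 ⟨by omega, not_lt.1 hc⟩
    have h6 := windowLen_succ h (show 1 ≤ numLevels n h - 1 by omega)
    rw [Nat.sub_add_cancel h1] at h6
    rw [h6]
    push_cast
    linarith
  · refine le_max_of_le_left ?_
    have : numLevels n h = 1 := by omega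
    rw [this]

/-! ### Success with high probability -/

open Classical in
/-- The source locations with a local obstruction. -/
noncomputable def badSet (h S : ℕ) (ω : Outcome n M) : Finset (Fin n) :=
  Finset.univ.filter fun j : Fin n => BadNear h S ω.1 ω.2.1 ω.2.2 j

theorem succeedsAt_of_not_bad (hr : Regime K δ M) {x : Fin n → Bool} {E : Deletions n}
    {D : Fin M → Deletions n} {l : ℕ} {j : Fin n}
    (hE : E j = false) (hj : keptBefore E j + 1 = l)
    (htop : ¬ BadLevel x E D (windowLen ⌈scaleH K δ M⌉₊ (numLevels n ⌈scaleH K δ M⌉₊)) j 0 n)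
    (hnear : ¬ BadNear ⌈scaleH K δ M⌉₊ (numLevels n ⌈scaleH K δ M⌉₊) x E D j)
    (hl1 : windowLen ⌈scaleH K δ M⌉₊ (numLevels n ⌈scaleH K δ M⌉₊) ≤ l)
    (hl2 : l + windowLen ⌈scaleH K δ M⌉₊ (numLevels n ⌈scaleH K δ M⌉₊) ≤ keptBefore E n) :
    SucceedsAt K δ x E D l := by
  intro ℓ hout
  have ht := hr.big_le_windowLen
  have hS := (numLevels_spec n ⌈scaleH K δ M⌉₊).1
  have hmono := windowLen_mono ⌈scaleH K δ M⌉₊ hS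
  have hlen := hr.windowLen_le
  have hH := hr.big_le_scaleH
  have hM : 0 < M := by exact_mod_cast hr.M_pos
  obtain ⟨i, h1, h2, h3⟩ := hout.success rfl hS (by omega) hM htop hnear hj (by omega) (by omega)
  refine ⟨i, j, isSource_iff.2 ⟨hE, hj⟩, h1, ?_, h3⟩
  have h4 : 40 * (j : ℕ) ≤ 40 * i + 21 * windowLen ⌈scaleH K δ M⌉₊ 1 := by omega
  have h5 : (40 * (j : ℕ) : ℝ) ≤ 40 * (i : ℕ) + 21 * windowLen ⌈scaleH K δ M⌉₊ 1 := by
    exact_mod_cast h4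
  linarith

/-- Distinct failures have distinct sources, and these are all bad. -/
theorem alignSucceeds_of_few_bad (hr : Regime K δ M)
    (hH : scaleH K δ M ≤ 2 * Real.logb 2 n) (ω : Outcome n M)
    (htop : ∀ j : Fin n, ¬ BadLevel ω.1 ω.2.1 ω.2.2
      (windowLen ⌈scaleH K δ M⌉₊ (numLevels n ⌈scaleH K δ M⌉₊)) j 0 n)
    (hcount : ((badSet ⌈scaleH K δ M⌉₊ (numLevels n ⌈scaleH K δ M⌉₊) ω).card : ℝ) ≤
      2 ^ (-0.1 * scaleH K δ M) * n) :
    AlignSucceeds K δ ω.1 ω.2.1 ω.2.2 := by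
  classical
  refine le_trans ?_ hcount
  set J := badSet ⌈scaleH K δ M⌉₊ (numLevels n ⌈scaleH K δ M⌉₊) ω with hJ
  have hspec := numLevels_spec n ⌈scaleH K δ M⌉₊
  have hlen := hr.windowLen_le
  have hbig := hr.big_le_scaleH
  have hT : (windowLen ⌈scaleH K δ M⌉₊ (numLevels n ⌈scaleH K δ M⌉₊) : ℝ) ≤
      1500 * Real.logb 2 n := hspec.2.2.trans (max_le (by linarith) le_rfl)
  refine Nat.cast_le.2 (le_trans (Set.ncard_le_ncard (t := ((J.image fun j : Fin n =>
    keptBefore ω.2.1 j + 1 : Finset ℕ) : Set ℕ)) ?_ (Finset.finite_toSet _)) ?_)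
  · rintro l ⟨h1, h2, h3⟩
    rw [length_trace] at h2
    rw [tauC_eq] at h1 h2
    have h4 : (windowLen ⌈scaleH K δ M⌉₊ (numLevels n ⌈scaleH K δ M⌉₊) : ℝ) ≤ l := by linarith
    have h5 : (l : ℝ) + windowLen ⌈scaleH K δ M⌉₊ (numLevels n ⌈scaleH K δ M⌉₊) ≤
        keptBefore ω.2.1 n := by linarith
    have h4' : windowLen ⌈scaleH K δ M⌉₊ (numLevels n ⌈scaleH K δ M⌉₊) ≤ l := by exact_mod_cast h4
    have h5' : l + windowLen ⌈scaleH K δ M⌉₊ (numLevels n ⌈scaleH K δ M⌉₊) ≤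
        keptBefore ω.2.1 n := by exact_mod_cast h5
    have hpos := (hr.big_le_windowLen).trans (windowLen_mono ⌈scaleH K δ M⌉₊ hspec.1)
    obtain ⟨j, hj1, hj2⟩ := exists_source (D := ω.2.1) (q := l) (by omega) (by omega)
    simp only [Finset.coe_image, Set.mem_image, Finset.mem_coe]
    refine ⟨j, ?_, hj2⟩
    rw [hJ, badSet, Finset.mem_filter]
    refine ⟨Finset.mem_univ _, ?_⟩
    by_contra hnear
    exact h3 (succeedsAt_of_not_bad hr hj1 hj2 (htop j) hnear h4' h5')
  · rw [Set.ncard_coe_finset]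
    exact Finset.card_image_le

/-- With high probability the top scale is good around all locations at once. -/
theorem outcomeLaw_top_le (hr : Regime K δ M) (hH : scaleH K δ M ≤ 2 * Real.logb 2 n)
    (hn : 0 < n) :
    (outcomeLaw n M δ).real {ω | ∃ j : Fin n, BadLevel ω.1 ω.2.1 ω.2.2
      (windowLen ⌈scaleH K δ M⌉₊ (numLevels n ⌈scaleH K δ M⌉₊)) j 0 n} ≤ 1 / (2 * n ^ 2) := by
  have := isProbabilityMeasure_outcomeLaw n M hr.δ_pos.le
    (hr.δ_le.trans (pow_le_one₀ (by norm_num) (by norm_num)))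
  have hspec := numLevels_spec n ⌈scaleH K δ M⌉₊
  have hmono := windowLen_mono ⌈scaleH K δ M⌉₊ hspec.1
  have hbig := hr.big_le_windowLen
  have hbigH := hr.big_le_scaleH
  set T := windowLen ⌈scaleH K δ M⌉₊ (numLevels n ⌈scaleH K δ M⌉₊)
  have hM : (M : ℝ) + 1 ≤ 2 ^ T := hr.M_succ_le.trans (by gcongr; norm_num)
  have h1 := measureReal_le_card_mul (outcomeLaw n M δ) (Finset.univ : Finset (Fin n))
    (A := {ω | ∃ j : Fin n, BadLevel ω.1 ω.2.1 ω.2.2 T j 0 n})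
    (B := fun j => {ω | BadLevel ω.1 ω.2.1 ω.2.2 T j 0 n}) (by
      rintro ω ⟨j, hj⟩
      simp only [Set.mem_iUnion]
      exact ⟨j, Finset.mem_univ j, hj⟩)
    fun j _ => outcomeLaw_badLevel_le' (hbig.trans hmono) hr.δ_pos.le hr.δ_le hM j 0 n
  refine h1.trans ?_
  rw [Finset.card_univ, Fintype.card_fin, Nat.sub_zero]
  have hn0 : (0 : ℝ) < n := by exact_mod_cast hn
  set y := Real.logb 2 n with hy
  have hny : (2 : ℝ) ^ y = n := Real.rpow_logb (by norm_num) (by norm_num) hn0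
  have h2 : (1 / 2 : ℝ) ^ (T / 3) ≤ 2 ^ (-(4 : ℝ) * y - 2) := by
    rw [half_pow_eq_rpow]
    refine Real.rpow_le_rpow_of_exponent_le (by norm_num) ?_
    have h3 : T ≤ 3 * (T / 3) + 3 := by omega
    have h4 : (T : ℝ) ≤ 3 * ((T / 3 : ℕ) : ℝ) + 3 := by exact_mod_cast h3
    have := hspec.2.1
    linarith
  have h3 : (2 : ℝ) ^ (-(4 : ℝ) * y - 2) = 1 / (4 * n ^ 4) := by
    rw [Real.rpow_sub (by norm_num), mul_comm, Real.rpow_mul (by norm_num), hny,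
      Real.rpow_neg hn0.le]
    norm_num
    ring
  rw [h3] at h2
  calc (n : ℝ) * (n * (2 * (1 / 2) ^ (T / 3))) ≤ n * (n * (2 * (1 / (4 * n ^ 4)))) := by gcongr
    _ = 1 / (2 * n ^ 2) := by
      field_simp
      ring

/-- With high probability few locations have a local obstruction. -/
theorem outcomeLaw_count_le (hr : Regime K δ M) (hH : scaleH K δ M ≤ 2 * Real.logb 2 n)
    (hn : 0 < n) :
    (outcomeLaw n M δ).real {ω | 2 ^ (-0.1 * scaleH K δ M) * (n : ℝ) <
      (badSet ⌈scaleH K δ M⌉₊ (numLevels n ⌈scaleH K δ M⌉₊) ω).card} ≤ 1 / (2 * n ^ 2) := by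
  classical
  have hδ1 : δ ≤ 1 := hr.δ_le.trans (pow_le_one₀ (by norm_num) (by norm_num))
  have := isProbabilityMeasure_outcomeLaw n M hr.δ_pos.le hδ1
  have hspec := numLevels_spec n ⌈scaleH K δ M⌉₊
  have hmono := windowLen_mono ⌈scaleH K δ M⌉₊ hspec.1
  have hbig := hr.big_le_windowLen
  have hlen := hr.windowLen_le
  have hbigH := hr.big_le_scaleH
  set S := numLevels n ⌈scaleH K δ M⌉₊ with hS
  set T := windowLen ⌈scaleH K δ M⌉₊ S with hT
  set H := scaleH K δ M with hHdef
  have hn0 : (0 : ℝ) < n := by exact_mod_cast hn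
  set y := Real.logb 2 n with hy
  have hny : (2 : ℝ) ^ y = n := Real.rpow_logb (by norm_num) (by norm_num) hn0
  have hy0 : 0 ≤ y := by linarith
  have hTy : (T : ℝ) ≤ 1500 * y := hspec.2.2.trans (max_le (by linarith) le_rfl)
  have hT1 : (1 : ℝ) ≤ T := by
    have : 1 ≤ T := by omega
    exact_mod_cast this
  set κ : ℝ := 2 ^ (-0.1 * H) * n with hκ
  have hκ0 : 0 < κ := by positivity
  -- The threshold `κ` is at least a power of `n`, the radius only logarithmic.
  have hκy : (10 : ℝ) ^ 6 * y * y ≤ κ := by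
    have h1 : (2 : ℝ) ^ (0.8 * y) ≤ κ := by
      rw [hκ, ← hny, ← Real.rpow_add (by norm_num)]
      exact Real.rpow_le_rpow_of_exponent_le (by norm_num) (by linarith)
    have h2 := one_add_le_two_rpow (p := 0.2 * y) (by linarith)
    have h3 : (2 : ℝ) ^ (0.8 * y) = (2 ^ (0.2 * y)) ^ 4 := by
      rw [← Real.rpow_natCast, ← Real.rpow_mul (by norm_num)]
      norm_num
      ring_nf
    rw [h3] at h1
    refine le_trans ?_ h1
    have h4 : (0.2 * y) ^ 4 ≤ ((2 : ℝ) ^ (0.2 * y)) ^ 4 :=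
      pow_le_pow_left₀ (by linarith) (by linarith) 4
    refine le_trans ?_ h4
    have h5 : (10 ^ 5 : ℝ) * 10 ^ 5 ≤ y * y :=
      mul_le_mul (by linarith) (by linarith) (by norm_num) (by linarith)
    have h6 : (10 : ℝ) ^ 6 ≤ 0.0016 * (y * y) := by linarith
    calc (10 : ℝ) ^ 6 * y * y = 10 ^ 6 * (y * y) := by ring
      _ ≤ 0.0016 * (y * y) * (y * y) := mul_le_mul_of_nonneg_right h6 (mul_self_nonneg y)
      _ = (0.2 * y) ^ 4 := by ring
  set R := 6 * T with hR
  set r := ⌊κ / (2 * R : ℕ)⌋₊ with hrdef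
  have hLpos : (0 : ℝ) < (2 * R : ℕ) := by
    rw [hR]
    push_cast
    linarith
  have hLy : ((2 * R : ℕ) : ℝ) ≤ 18000 * y := by
    rw [hR]
    push_cast
    linarith
  have hrle : (r : ℝ) ≤ κ / (2 * R : ℕ) := Nat.floor_le (by positivity)
  have hkL : 50 * y ≤ κ / (2 * R : ℕ) := by
    rw [le_div_iff₀ hLpos]
    calc 50 * y * (2 * R : ℕ) ≤ 50 * y * (18000 * y) := by gcongr
      _ = 900000 * (y * y) := by ring
      _ ≤ 10 ^ 6 * (y * y) := mul_le_mul_of_nonneg_right (by norm_num) (mul_self_nonneg y)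
      _ ≤ κ := by linarith
  have hrge : κ / (2 * R : ℕ) / 2 ≤ r := by
    have := Nat.lt_floor_add_one (κ / (2 * R : ℕ))
    linarith
  have hr0 : (0 : ℝ) < r := by linarith
  have hr0' : 0 < r := by exact_mod_cast hr0
  have hsub : {ω : Outcome n M | κ < (badSet ⌈H⌉₊ S ω).card} ⊆
      {ω | 2 * R * r < (badSet ⌈H⌉₊ S ω).card} := by
    intro ω hω
    rw [le_div_iff₀ hLpos] at hrle
    have h1 : ((2 * R * r : ℕ) : ℝ) < (badSet ⌈H⌉₊ S ω).card := by
      rw [Nat.cast_mul, mul_comm]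
      exact hrle.trans_lt hω
    exact_mod_cast h1
  refine (measureReal_mono hsub (measure_ne_top _ _)).trans
    ((outcomeLaw_card_ge_le hr.δ_pos.le hδ1 (by omega) _ (2 ^ (-0.3 * H)) (by positivity)
      (fun j ω ω' hω hb => hb.congr hspec.1 le_rfl hω) (fun j => hr.badNear_le S j) r).trans ?_)
  -- Each class has at most `2 n / (2 R)` elements.
  have hclass : ((n / (2 * R) + 1 : ℕ) : ℝ) ≤ 2 * n / (2 * R : ℕ) := by
    have h1 : ((n / (2 * R) : ℕ) : ℝ) ≤ n / (2 * R : ℕ) := Nat.cast_div_le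
    have h2 : (1 : ℝ) ≤ n / (2 * R : ℕ) := by
      rw [le_div_iff₀ hLpos, one_mul]
      have h3 : κ ≤ n := by
        rw [hκ]
        exact mul_le_of_le_one_left hn0.le
          (Real.rpow_le_one_of_one_le_of_nonpos (by norm_num) (by linarith))
      have h4 := mul_le_mul_of_nonneg_left hkL hLpos.le
      rw [mul_div_cancel₀ _ hLpos.ne'] at h4
      have h5 : ((2 * R : ℕ) : ℝ) * 1 ≤ (2 * R : ℕ) * (50 * y) := by
        gcongr
        linarith
      linarith
    rw [Nat.cast_add, Nat.cast_one, mul_div_assoc]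
    linarith
  have hbase : 3 * ((n / (2 * R) + 1 : ℕ) : ℝ) / r * 2 ^ (-0.3 * H) ≤ 1 / 2 := by
    have h1 : 3 * ((n / (2 * R) + 1 : ℕ) : ℝ) / r ≤ 12 * n / κ := by
      rw [div_le_div_iff₀ hr0 hκ0]
      have h2 : κ ≤ 2 * r * (2 * R : ℕ) := by
        rw [div_div, div_le_iff₀ (by positivity)] at hrge
        linarith
      have h3 : ((n / (2 * R) + 1 : ℕ) : ℝ) * (2 * R : ℕ) ≤ 2 * n := by
        rwa [le_div_iff₀ hLpos] at hclass
      calc 3 * ((n / (2 * R) + 1 : ℕ) : ℝ) * κ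
          ≤ 3 * ((n / (2 * R) + 1 : ℕ) : ℝ) * (2 * r * (2 * R : ℕ)) := by gcongr
        _ = 6 * r * (((n / (2 * R) + 1 : ℕ) : ℝ) * (2 * R : ℕ)) := by ring
        _ ≤ 6 * r * (2 * n) := by gcongr
        _ = 12 * n * r := by ring
    have h2 : (12 * n / κ : ℝ) * 2 ^ (-0.3 * H) = 12 * 2 ^ (-0.2 * H) := by
      have h3 : (2 : ℝ) ^ (-0.3 * H) = 2 ^ (-0.2 * H) * 2 ^ (-0.1 * H) := by
        rw [← Real.rpow_add (by norm_num)]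
        ring_nf
      rw [h3, hκ]
      field_simp
    have h3 : (2 : ℝ) ^ (-0.2 * H) ≤ 2 ^ (-5 : ℝ) :=
      Real.rpow_le_rpow_of_exponent_le (by norm_num) (by linarith)
    have h4 : (2 : ℝ) ^ (-5 : ℝ) = 1 / 32 := by
      rw [Real.rpow_neg (by norm_num)]
      norm_num
    calc _ ≤ (12 * n / κ : ℝ) * 2 ^ (-0.3 * H) := by gcongr
      _ = 12 * 2 ^ (-0.2 * H) := h2
      _ ≤ 1 / 2 := by linarith
  have hpow : ((n / (2 * R) + 1).choose r : ℝ) * (2 ^ (-0.3 * H)) ^ r ≤ (1 / 2) ^ r := by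
    calc _ ≤ (3 * ((n / (2 * R) + 1 : ℕ) : ℝ) / r) ^ r * (2 ^ (-0.3 * H)) ^ r := by
          gcongr
          exact choose_le_pow _ _ hr0'
      _ = (3 * ((n / (2 * R) + 1 : ℕ) : ℝ) / r * 2 ^ (-0.3 * H)) ^ r := by rw [mul_pow]
      _ ≤ _ := by gcongr
  have hhalf : (1 / 2 : ℝ) ^ r ≤ 1 / n ^ 4 := by
    have h1 : (1 / 2 : ℝ) ^ r ≤ 2 ^ (y * (-4 : ℝ)) := by
      rw [half_pow_eq_rpow]
      exact Real.rpow_le_rpow_of_exponent_le (by norm_num) (by linarith)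
    have h2 : (n : ℝ) ^ (4 : ℝ) = n ^ 4 := by
      rw [← Real.rpow_natCast]
      norm_num
    rwa [Real.rpow_mul (by norm_num), hny, Real.rpow_neg hn0.le, h2, ← one_div] at h1
  have hyn : 36000 * y ≤ (n : ℝ) ^ 2 := by
    have h1 := one_add_le_two_rpow (p := y) (by linarith)
    rw [hny] at h1
    calc 36000 * y ≤ (n : ℝ) * n :=
          mul_le_mul (by linarith) (by linarith) hy0 hn0.le
      _ = (n : ℝ) ^ 2 := (pow_two _).symm
  calc _ ≤ 18000 * y * (1 / n ^ 4) :=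
        mul_le_mul hLy (hpow.trans hhalf) (by positivity) (by positivity)
    _ ≤ (n ^ 2 / 2) * (1 / n ^ 4) := by
        gcongr
        linarith
    _ = 1 / (2 * n ^ 2) := by
        field_simp

end TraceAlign


theorem mainTheorem3 :
    ∃ K₀ : ℝ, 0 < K₀ ∧ ∀ K : ℝ, K₀ ≤ K → ∀ (n M : ℕ) (δ : ℝ), 0 < n →
      1 / (n : ℝ) ^ 2 ≤ δ → δ < 1 / (K * M) → 1 / (K * M) < 1 / K →
      K ^ 2 ≤ M → (M : ℝ) ≤ 1 / (K * δ) →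
      TraceAlign.scaleH K δ M ≤ 2 * Real.logb 2 n →
      1 - 1 / (n : ℝ) ^ 2 ≤ (TraceAlign.outcomeLaw n M δ).real
        {ω | TraceAlign.AlignSucceeds K δ ω.1 ω.2.1 ω.2.2} := by
  classical
  -- With this `K₀`, `δ ≤ 2 ^ (-1000)`, so that `δ ^ (t / 400)` outweighs the number of ways to place
  -- `t / 400` deletions.
  refine ⟨2 ^ 1000, by positivity, fun K hK n M δ hn hδ hδK _ hKM _ hH => ?_⟩
  have hn0 : (0 : ℝ) < n := by exact_mod_cast hn
  have hr : TraceAlign.Regime K δ M := ⟨hK, lt_of_lt_of_le (by positivity) hδ, hδK, hKM⟩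
  have := TraceAlign.isProbabilityMeasure_outcomeLaw n M hr.δ_pos.le
    (hr.δ_le.trans (pow_le_one₀ (by norm_num) (by norm_num)))
  have h1 := TraceAlign.outcomeLaw_top_le hr hH hn
  have h2 := TraceAlign.outcomeLaw_count_le hr hH hn
  have hcompl := probReal_compl_eq_one_sub (μ := TraceAlign.outcomeLaw n M δ)
    (s := {ω | TraceAlign.AlignSucceeds K δ ω.1 ω.2.1 ω.2.2}) MeasurableSet.of_discrete
  have h3 : (TraceAlign.outcomeLaw n M δ).real
      {ω | TraceAlign.AlignSucceeds K δ ω.1 ω.2.1 ω.2.2}ᶜ ≤ 1 / (2 * n ^ 2) + 1 / (2 * n ^ 2) := by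
    refine (measureReal_mono ?_ (measure_ne_top _ _)).trans
      ((measureReal_union_le _ _).trans (add_le_add h1 h2))
    intro ω hω
    by_contra hc
    rw [Set.mem_union, not_or] at hc
    exact hω (TraceAlign.alignSucceeds_of_few_bad hr hH ω
      (fun j hj => hc.1 ⟨j, hj⟩) (not_lt.1 hc.2))
  have h4 : (1 : ℝ) / (2 * n ^ 2) + 1 / (2 * n ^ 2) = 1 / n ^ 2 := by
    field_simp
    norm_num
  linarith
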